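/- Let $\varphi:[0,\infty)\to[0,\infty)$ be a modulus of continuity (nondecreasing, $\varphi(0)=0$, $\varphi(r)>0$ for $r>0$, $\varphi(r)\to0$ as $r\to0^+$), and let $0<\theta<\tfrac12$ be such that $$\int_0^r\frac{\varphi(s)^\theta}{s}\,ds\to0\quad\text{as } r\to0^+ .$$ Write $\|u\|_{C^0}=\sup_{\mathbb R}|u|$ and $\|u\|_{C^\varphi}=\|u\|_{C^0}+\sup_{x\ne y}\frac{|u(x)-u(y)|}{\varphi(|x-y|)}$, let $C^\varphi=C^\varphi(\mathbb R)$ be the space of functions $u:\mathbb R\to\mathbb R$ with $\|u\|_{C^\varphi}<\infty$, and let $$\mathcal H[u](x)=\frac1\pi\,\mathrm{p.v.}\!\int_{\mathbb R}\frac{u(y)}{x-y}\,dy ,$$ where all principal values are limits of integrals over $\varepsilon<|x-y|<R$ as $\varepsilon\to0^+$, $R\to\infty$. Let $f,g:\mathbb R\to\mathbb R$ be continuous with compact support, and assume that $\mathcal H[f],\mathcal H[g]\in C^\varphi$ (that is, they agree almost everywhere with functions of $C^\varphi$, denoted by the same symbols). Then $\mathcal H[fg]$ exists at every point, $\mathcal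 H[fg]\in C^\varphi$, and for every $x\in\mathbb R$ $$\mathcal H[fg](x)=\frac1\pi\,\mathrm{p.v.}\!\int_{\mathbb R}\frac{\big(\mathcal H[f](x)-\mathcal H[f](y)\big)\big(\mathcal H[g](x)-\mathcal H[g](y)\big)}{x-y}\,dy ,$$ where this principal value exists. Moreover, for every $L$ there is a constant $C$ depending only on $\varphi$, $\theta$ and $L$ such that, whenever the supports of $f$ and of $g$ have diameter at most $L$, $$\|\mathcal H[fg]\|_{C^\varphi}\le C\Big(\|\mathcal H[f]\|_{C^\varphi}\big(\|\mathcal H[g]\|_{C^\varphi}^{\theta}\|\mathcal H[g]\|_{C^0}^{1-\theta}+\|\mathcal H[g]\|_{C^0}\big)+\|\mathcal H[g]\|_{C^\varphi}\big(\|f\|_{C^0}+\|\mathcal H[f]\|_{C^0}\big)\Big)$$ and $$\|\mathcal H[fg]\|_{C^\varphi}\le C\,\|\mathcal H[f]\|_{C^\varphi}\,\|\mathcal H[g]\|_{C^\varphi}.$$ -/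

import Mathlib

open MeasureTheory Set Filter Topology

/-- A modulus of continuity: a nondecreasing function on `[0, ∞)` vanishing at `0`, positive on
`(0, ∞)`, and tending to `0` at `0`. Its values on the negative half-line are never used. -/
structure IsModulus (φ : ℝ → ℝ) : Prop where
  zero : φ 0 = 0
  pos : ∀ r, 0 < r → 0 < φ r
  mono : MonotoneOn φ (Ici 0)
  tendsto_zero : Tendsto φ (𝓝[>] 0) (𝓝 0)

/-- The condition `∫₀ʳ φ(s)^θ / s ds → 0` as `r → 0⁺`. The integrand is nonnegative, and the
integral is taken in `[0, ∞]`, so that divergence is not hidden. -/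
def DiniPow (φ : ℝ → ℝ) (θ : ℝ) : Prop :=
  Tendsto (fun r : ℝ => ∫⁻ s in Ioc 0 r, ENNReal.ofReal (φ s ^ θ / s)) (𝓝[>] 0) (𝓝 0)

/-- `f ∈ C^φ(ℝ)`: `f` is bounded and `|f x - f y| ≤ M φ(|x - y|)` for some `M`. -/
structure MemCPhi (φ : ℝ → ℝ) (f : ℝ → ℝ) : Prop where
  bounded : ∃ M : ℝ, ∀ x, |f x| ≤ M
  modulus : ∃ M : ℝ, ∀ x y, |f x - f y| ≤ M * φ |x - y|

/-- The norm `‖f‖_{C⁰} = sup |f|` (meaningful for bounded `f`). -/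
noncomputable def normC0 (f : ℝ → ℝ) : ℝ := ⨆ x, |f x|

/-- The seminorm `sup_{x ≠ y} |f x - f y| / φ(|x - y|)` (meaningful for `f ∈ C^φ`).
Pairs with `x = y` contribute `0 / φ 0 = 0`. -/
noncomputable def seminormCPhi (φ f : ℝ → ℝ) : ℝ :=
  ⨆ p : ℝ × ℝ, |f p.1 - f p.2| / φ |p.1 - p.2|

/-- The norm `‖f‖_{C^φ}`: sup norm plus the `φ`-seminorm. -/
noncomputable def normCPhi (φ f : ℝ → ℝ) : ℝ := normC0 f + seminormCPhi φ f

/-- `P.V. ∫ k(y) dy = v`, where the principal value is taken symmetrically about the point `x`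
both at `x` and at infinity: the integrals of `k` over `ε < |x - y| < R` all exist, and
converge to `v` as `ε → 0⁺` and `R → ∞`. -/
def HasPV (k : ℝ → ℝ) (x v : ℝ) : Prop :=
  (∀ ε R : ℝ, 0 < ε → IntegrableOn k {y | ε < |x - y| ∧ |x - y| < R}) ∧
  Tendsto (fun p : ℝ × ℝ => ∫ y in {y | p.1 < |x - y| ∧ |x - y| < p.2}, k y)
    (𝓝[>] 0 ×ˢ atTop) (𝓝 v)

/-- The Hilbert transform of `f` exists at `x` and has the value `v`:
`v = (1/π) P.V. ∫ f(y) / (x - y) dy`. -/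
def HasHilbertAt (f : ℝ → ℝ) (x v : ℝ) : Prop :=
  ∃ I : ℝ, HasPV (fun y => f y / (x - y)) x I ∧ v = (1 / Real.pi) * I

/-! Write F = H[f] and G = H[g], and let P_h, Q_h be the Poisson and conjugate Poisson integrals at
height h, without the factor 1/π. The Cauchy transform of f at x + ih is Q_h f - i P_h f, and its
boundary value is π(F - i f). By contour integration its square has integral zero along horizontal
lines, so the real and imaginary parts have equal L² norms (`UpperDecay.eLpNorm_re_eq`). Hence Q_h f
converges in L² because P_h f does. Integrating the boundary value of f, and the product of those of
f and g, against 1/(t - x + ih), whose pole lies below the axis, gives zero. Real parts yield, at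
every height h, Q_h F = -P_h f (`IsConjugate.conjPoisson_eq`), Q_h(fg) = Q_h(FG) + P_h(fG + gF)
(`IsConjugate.conjPoisson_mul_eq`).

Existence and formula. Since the conjugate Poisson kernel is odd, the principal value of the product
of increments equals `nearPart` + `farPart` at every height 0 < h ≤ 1
(`hasPV_nearPart_add_farPart`). As h → 0 the near part vanishes, because one increment contributes
φ(h) and the other an integrable Dini kernel. By the two identities the far part is Q_h(fg) plus
Poisson terms that cancel in the limit. So Q_h(fg)(x) converges at every x, which is equivalent to
the existence of H[fg](x) (`hasHilbertAt_iff`, `hasHilbertAt_mul`).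

Modulus of continuity. The freedom in h is used by taking h = |x - x'| at both points. The near
parts are O(φ(h)) (`abs_nearPart_le`). In the difference of far parts the kernel increment has
integral zero and Poisson size, so increments of F and G can be inserted again
(`abs_farPart_sub_le`). Only the increment of G is interpolated, as E φ^θ with E comparable to
‖G‖_{C^φ}^θ ‖G‖_{C⁰}^(1-θ); the increment of F keeps the full factor φ(h). The tail |x' - y| > 1
contributes O(h), which is O(φ(h)) unless C^φ consists of constants, a trivial case
(`exists_linear_lower_bound_or_const`).

Sup norms. By the first identity, P_h g = -Q_h G is bounded through the Dini kernel, ‖G‖_{C⁰}, and a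
tail controlled by ‖G‖_{L²} ≤ ‖g‖_{L²}. The tail costs at most ‖g‖_{C⁰}, which is absorbed since P_h
g → πg (`IsConjugate.normC0_le`). This removes ‖g‖_{C⁰} from the first estimate and both ‖f‖_{C⁰}
and ‖g‖_{C⁰} from the second. -/

/-! ### Poisson and conjugate Poisson integrals -/

/-- The Poisson integral of `w` at height `h`, up to the factor `1 / π`. -/
noncomputable def poisson (w : ℝ → ℝ) (h x : ℝ) : ℝ := ∫ y, w y * (h / ((x - y) ^ 2 + h ^ 2))

/-- The conjugate Poisson integral of `w` at height `h`, up to the factor `1 / π`. -/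
noncomputable def conjPoisson (w : ℝ → ℝ) (h x : ℝ) : ℝ :=
  ∫ y, w y * ((x - y) / ((x - y) ^ 2 + h ^ 2))

lemma sq_add_sq_pos (s : ℝ) {h : ℝ} (hh : 0 < h) : 0 < s ^ 2 + h ^ 2 := by positivity

lemma poissonKernel_nonneg (s : ℝ) {h : ℝ} (hh : 0 < h) : 0 ≤ h / (s ^ 2 + h ^ 2) := by positivity

lemma continuous_conjPoissonKernel {h : ℝ} (hh : 0 < h) :
    Continuous fun s : ℝ => s / (s ^ 2 + h ^ 2) :=
  continuous_id.div (by fun_prop) fun s => (sq_add_sq_pos s hh).ne'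

lemma poissonKernel_eq {h : ℝ} (hh : 0 < h) (s : ℝ) :
    h / (s ^ 2 + h ^ 2) = h⁻¹ * (1 + (h⁻¹ * s) ^ 2)⁻¹ := by
  field_simp
  ring

lemma integrable_poissonKernel {h : ℝ} (hh : 0 < h) :
    Integrable fun s : ℝ => h / (s ^ 2 + h ^ 2) := by
  simp_rw [poissonKernel_eq hh]
  exact (integrable_inv_one_add_sq.comp_mul_left' (inv_ne_zero hh.ne')).const_mul _

lemma integral_poissonKernel {h : ℝ} (hh : 0 < h) : ∫ s : ℝ, h / (s ^ 2 + h ^ 2) = Real.pi := by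
  simp_rw [poissonKernel_eq hh]
  rw [integral_const_mul, Measure.integral_comp_mul_left (fun s : ℝ => (1 + s ^ 2)⁻¹),
    integral_univ_inv_one_add_sq, inv_inv, abs_of_pos hh, smul_eq_mul, ← mul_assoc,
    inv_mul_cancel₀ hh.ne', one_mul]

lemma integrable_poissonKernel_sub {h : ℝ} (hh : 0 < h) (x : ℝ) :
    Integrable fun y : ℝ => h / ((x - y) ^ 2 + h ^ 2) :=
  (integrable_poissonKernel hh).comp_sub_left x

lemma integral_poissonKernel_sub {h : ℝ} (hh : 0 < h) (x : ℝ) :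
    ∫ y : ℝ, h / ((x - y) ^ 2 + h ^ 2) = Real.pi := by
  rw [integral_sub_left_eq_self (fun s : ℝ => h / (s ^ 2 + h ^ 2)), integral_poissonKernel hh]

lemma integrable_mul_poissonKernel {w : ℝ → ℝ} (hw : Continuous w) {M : ℝ} (hM : ∀ x, |w x| ≤ M)
    {h : ℝ} (hh : 0 < h) (x : ℝ) : Integrable fun y => w y * (h / ((x - y) ^ 2 + h ^ 2)) :=
  (integrable_poissonKernel_sub hh x).bdd_mul hw.aestronglyMeasurable (Eventually.of_forall hM)

lemma abs_poisson_le {w : ℝ → ℝ} {M : ℝ} (hM : ∀ x, |w x| ≤ M) {h : ℝ} (hh : 0 < h) (x : ℝ) :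
    |poisson w h x| ≤ Real.pi * M := by
  rw [← integral_poissonKernel_sub hh x, mul_comm, ← integral_const_mul]
  refine norm_integral_le_of_norm_le (f := fun y => w y * (h / ((x - y) ^ 2 + h ^ 2)))
    ((integrable_poissonKernel_sub hh x).const_mul M) (Eventually.of_forall fun y => ?_)
  rw [norm_mul, Real.norm_of_nonneg (poissonKernel_nonneg _ hh)]
  exact mul_le_mul_of_nonneg_right (hM y) (poissonKernel_nonneg _ hh)

lemma poisson_eq_integral_scaled (w : ℝ → ℝ) {h : ℝ} (hh : 0 < h) (x : ℝ) :
    poisson w h x = ∫ s, w (x - h * s) * (1 + s ^ 2)⁻¹ := by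
  have h1 := integral_sub_left_eq_self (fun s : ℝ => w (x - s) * (h / (s ^ 2 + h ^ 2))) volume x
  have h2 := Measure.integral_comp_mul_left (fun s : ℝ => w (x - s) * (h / (s ^ 2 + h ^ 2))) h
  simp only [sub_sub_cancel] at h1
  rw [poisson, h1]
  rw [abs_of_pos (inv_pos.2 hh), smul_eq_mul] at h2
  rw [eq_comm, ← mul_right_inj' (inv_ne_zero hh.ne'), ← h2, ← integral_const_mul]
  congr 1
  ext s
  field_simp
  ring

lemma tendsto_poisson {w : ℝ → ℝ} (hw : Continuous w) {M : ℝ} (hM : ∀ x, |w x| ≤ M) (x : ℝ) :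
    Tendsto (fun h => poisson w h x) (𝓝[>] 0) (𝓝 (Real.pi * w x)) := by
  have key : Tendsto (fun h : ℝ => ∫ s, w (x - h * s) * (1 + s ^ 2)⁻¹) (𝓝[>] 0)
      (𝓝 (∫ s, w x * (1 + s ^ 2)⁻¹)) := by
    refine tendsto_integral_filter_of_dominated_convergence (fun s => M * (1 + s ^ 2)⁻¹)
      (Eventually.of_forall fun h => ?_) (Eventually.of_forall fun h => ae_of_all _ fun s => ?_)
      (integrable_inv_one_add_sq.const_mul M) (ae_of_all _ fun s => ?_)
    · exact (hw.comp (by fun_prop)).aestronglyMeasurable.mul integrable_inv_one_add_sq.1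
    · rw [norm_mul, Real.norm_of_nonneg (by positivity : 0 ≤ (1 + s ^ 2)⁻¹)]
      exact mul_le_mul_of_nonneg_right (hM _) (by positivity)
    · refine Tendsto.mul_const _ ?_
      have : Tendsto (fun h : ℝ => w (x - h * s)) (𝓝 0) (𝓝 (w (x - 0 * s))) :=
        (hw.comp (by fun_prop : Continuous fun h : ℝ => x - h * s)).tendsto 0
      simp only [zero_mul, sub_zero] at this
      exact this.mono_left nhdsWithin_le_nhds
  rw [integral_const_mul, integral_univ_inv_one_add_sq, mul_comm] at key
  refine key.congr' ?_
  filter_upwards [self_mem_nhdsWithin] with h hh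
  exact (poisson_eq_integral_scaled w hh x).symm

lemma conjPoissonKernel_neg (h s : ℝ) : -s / ((-s) ^ 2 + h ^ 2) = -(s / (s ^ 2 + h ^ 2)) := by
  rw [neg_sq, neg_div]

lemma abs_conjPoissonKernel_le_inv (h s : ℝ) : |s / (s ^ 2 + h ^ 2)| ≤ |s|⁻¹ := by
  rcases eq_or_ne s 0 with rfl | hs
  · simp
  rw [abs_div, abs_of_nonneg (by positivity : 0 ≤ s ^ 2 + h ^ 2), inv_eq_one_div,
    div_le_div_iff₀ (by positivity) (abs_pos.2 hs), one_mul, abs_mul_abs_self]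
  nlinarith [sq_nonneg h]

/-- The conjugate Poisson kernel and the truncated kernel `1 / s` differ by at most the Poisson
kernel. -/
lemma abs_conjPoissonKernel_sub_le {h : ℝ} (hh : 0 < h) (s : ℝ) :
    |s / (s ^ 2 + h ^ 2) - (if h < |s| then s⁻¹ else 0)| ≤ h / (s ^ 2 + h ^ 2) := by
  have hp := sq_add_sq_pos s hh
  split_ifs with hs
  · have hs0 : s ≠ 0 := abs_pos.1 (hh.trans hs)
    have : s / (s ^ 2 + h ^ 2) - s⁻¹ = -(h ^ 2 / s) / (s ^ 2 + h ^ 2) := by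
      field_simp
      ring
    rw [this, abs_div, abs_of_pos hp, abs_neg, abs_div, abs_of_nonneg (sq_nonneg h)]
    refine div_le_div_of_nonneg_right ?_ hp.le
    rw [div_le_iff₀ (abs_pos.2 hs0)]
    nlinarith
  · rw [sub_zero, abs_div, abs_of_pos hp]
    exact div_le_div_of_nonneg_right (not_lt.1 hs) hp.le

lemma memLp_two_conjPoissonKernel {h : ℝ} (hh : 0 < h) (x : ℝ) :
    MemLp (fun y : ℝ => (x - y) / ((x - y) ^ 2 + h ^ 2)) 2 := by
  rw [memLp_two_iff_integrable_sq]
  · refine Integrable.mono' ((integrable_poissonKernel_sub hh x).const_mul h⁻¹) ?_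
      (ae_of_all _ fun y => ?_)
    · exact (((continuous_conjPoissonKernel hh).comp
        (continuous_const.sub continuous_id)).pow 2).aestronglyMeasurable
    · have hp := sq_add_sq_pos (x - y) hh
      rw [Real.norm_of_nonneg (sq_nonneg _), div_pow, ← mul_div_assoc, inv_mul_cancel₀ hh.ne',
        div_le_div_iff₀ (by positivity) hp]
      nlinarith [mul_nonneg hp.le (sq_nonneg h)]
  · exact ((continuous_conjPoissonKernel hh).comp
        (continuous_const.sub continuous_id)).aestronglyMeasurable

lemma integrable_mul_conjPoissonKernel {w : ℝ → ℝ} (hw : MemLp w 2) {h : ℝ} (hh : 0 < h) (x : ℝ) :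
    Integrable fun y => w y * ((x - y) / ((x - y) ^ 2 + h ^ 2)) :=
  hw.integrable_mul (memLp_two_conjPoissonKernel hh x)

lemma abs_conjPoissonKernel_le {h : ℝ} (hh : 0 < h) (s : ℝ) :
    |s / (s ^ 2 + h ^ 2)| ≤ h⁻¹ := by
  have hp := sq_add_sq_pos s hh
  rw [abs_div, abs_of_pos hp, div_le_iff₀ hp, ← div_eq_inv_mul, le_div_iff₀ hh]
  nlinarith [sq_nonneg (|s| - h), sq_abs s, sq_nonneg s]

lemma integrable_mul_conjPoissonKernel_of_integrable {w : ℝ → ℝ} (hw : Integrable w) {h : ℝ}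
    (hh : 0 < h) (x : ℝ) : Integrable fun y => w y * ((x - y) / ((x - y) ^ 2 + h ^ 2)) :=
  hw.mul_bdd ((continuous_conjPoissonKernel hh).comp
        (continuous_const.sub continuous_id)).aestronglyMeasurable
    (Eventually.of_forall fun y => abs_conjPoissonKernel_le hh (x - y))

/-! ### Boundary values of Cauchy transforms -/

-- Cauchy's theorem on the rectangle [-R, R] × [0, R]: the three sides off the real axis have total
-- length 4R and lie where |z| ≥ R, so they contribute at most 4C/R.
open Complex in
lemma integral_eq_zero_of_upperHalfPlane_decay {Ψ : ℂ → ℂ} {C : ℝ}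
    (hd : ∀ z : ℂ, 0 ≤ z.im → DifferentiableAt ℂ Ψ z)
    (hb : ∀ z : ℂ, 0 ≤ z.im → ‖Ψ z‖ ≤ C / (1 + ‖z‖ ^ 2)) : ∫ x : ℝ, Ψ x = 0 := by
  have hC : 0 ≤ C := by simpa using (norm_nonneg _).trans (hb 0 (by simp))
  have hc : Continuous fun x : ℝ => Ψ x :=
    continuous_iff_continuousAt.2 fun x => ContinuousAt.comp (f := fun x : ℝ => (x : ℂ))
      (hd x (by simp)).continuousAt continuous_ofReal.continuousAt
  have hint : Integrable fun x : ℝ => Ψ x := by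
    refine Integrable.mono' (integrable_inv_one_add_sq.const_mul C) hc.aestronglyMeasurable
      (ae_of_all _ fun x => ?_)
    simpa [div_eq_mul_inv] using hb x (by simp)
  have h1 : Tendsto (fun R : ℝ => ∫ x in (-R)..R, Ψ x) atTop (𝓝 (∫ x : ℝ, Ψ x)) :=
    intervalIntegral_tendsto_integral hint tendsto_neg_atTop_atBot tendsto_id
  have h2 : Tendsto (fun R : ℝ => ∫ x in (-R)..R, Ψ x) atTop (𝓝 0) := by
    have hbd : Tendsto (fun R : ℝ => 4 * C * R⁻¹) atTop (𝓝 0) := by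
      simpa using tendsto_inv_atTop_zero.const_mul (4 * C)
    refine squeeze_zero_norm' ?_ hbd
    filter_upwards [eventually_gt_atTop 0] with R hR
    have key := integral_boundary_rect_eq_zero_of_differentiableOn Ψ (-R : ℂ) (R + R * I)
      (fun z hz => by
        have : z ∈ _ ∧ z ∈ _ := hz
        refine (hd z ?_).differentiableWithinAt
        have h3 := this.2
        simp only [mem_preimage] at h3
        rw [uIcc_of_le (by simp [hR.le])] at h3
        simpa using h3.1)
    simp only [neg_re, ofReal_re, add_re, mul_re, I_re, mul_zero, ofReal_im, I_im, mul_one,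
      sub_self, add_zero, neg_im, neg_zero, ofReal_zero, zero_mul, add_im, mul_im, zero_add]
      at key
    have hle : ∀ z : ℂ, 0 ≤ z.im → R ≤ ‖z‖ → ‖Ψ z‖ ≤ C / R ^ 2 := fun z hz hRz =>
      (hb z hz).trans (div_le_div_of_nonneg_left hC (by positivity) (by nlinarith))
    have b1 : ‖∫ x in (-R)..R, Ψ (x + R * I)‖ ≤ C / R ^ 2 * |R - -R| :=
      intervalIntegral.norm_integral_le_of_norm_le_const fun x _ => hle _ (by simp [hR.le]) (by
        have := abs_im_le_norm (x + R * I : ℂ)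
        simp only [add_im, ofReal_im, mul_im, ofReal_re, I_im, mul_one, I_re, mul_zero, add_zero,
          zero_add] at this
        exact (le_abs_self R).trans this)
    have b2 : ‖∫ y in (0 : ℝ)..R, Ψ (R + y * I)‖ ≤ C / R ^ 2 * |R - 0| :=
      intervalIntegral.norm_integral_le_of_norm_le_const fun y hy => hle _
        (by rw [uIoc_of_le hR.le] at hy; simpa using hy.1.le) (by
        have := abs_re_le_norm (R + y * I : ℂ)
        simp only [add_re, ofReal_re, mul_re, I_re, mul_zero, ofReal_im, I_im, mul_one, sub_self,
          add_zero] at this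
        exact (le_abs_self R).trans this)
    have b3 : ‖∫ y in (0 : ℝ)..R, Ψ (-R + y * I)‖ ≤ C / R ^ 2 * |R - 0| :=
      intervalIntegral.norm_integral_le_of_norm_le_const fun y hy => hle _
        (by rw [uIoc_of_le hR.le] at hy; simpa using hy.1.le) (by
        have := abs_re_le_norm (-R + y * I : ℂ)
        simp only [add_re, neg_re, ofReal_re, mul_re, I_re, mul_zero, ofReal_im, I_im, mul_one,
          sub_self, add_zero, abs_neg] at this
        exact (le_abs_self R).trans this)
    push_cast at key
    have e : ∫ x in (-R)..R, Ψ x = (∫ x in (-R)..R, Ψ (x + R * I))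
        - I • (∫ y in (0 : ℝ)..R, Ψ (R + y * I)) + I • ∫ y in (0 : ℝ)..R, Ψ (-R + y * I) := by
      linear_combination key
    rw [e]
    refine (norm_add_le_of_le (norm_sub_le_of_le b1 ((norm_smul_le _ _).trans ?_))
      ((norm_smul_le _ _).trans ?_)).trans (?_ : _ + C / R ^ 2 * |R - 0| + C / R ^ 2 * |R - 0| ≤ _)
    · simpa using b2
    · simpa using b3
    · rw [sub_zero, sub_neg_eq_add, abs_of_pos hR, abs_of_pos (by linarith)]
      apply le_of_eq
      field_simp
      ring
  exact tendsto_nhds_unique h1 h2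

/-- `Ψ` is holomorphic on a neighbourhood of the closed upper half-plane, on which it is
`O(1 / (1 + |z|))`. -/
structure UpperDecay (Ψ : ℂ → ℂ) : Prop where
  differentiableAt : ∀ z : ℂ, 0 ≤ z.im → DifferentiableAt ℂ Ψ z
  bound : ∃ C : ℝ, ∀ z : ℂ, 0 ≤ z.im → ‖Ψ z‖ ≤ C / (1 + ‖z‖)

namespace UpperDecay

variable {Ψ Ψ' : ℂ → ℂ}

lemma sub (h : UpperDecay Ψ) (h' : UpperDecay Ψ') : UpperDecay fun z => Ψ z - Ψ' z := by
  obtain ⟨C, hC⟩ := h.bound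
  obtain ⟨C', hC'⟩ := h'.bound
  refine ⟨fun z hz => (h.1 z hz).sub (h'.1 z hz), C + C', fun z hz => ?_⟩
  rw [add_div]
  exact norm_sub_le_of_le (hC z hz) (hC' z hz)

lemma mul (h : UpperDecay Ψ) (h' : UpperDecay Ψ') : UpperDecay fun z => Ψ z * Ψ' z := by
  obtain ⟨C, hC⟩ := h.bound
  obtain ⟨C', hC'⟩ := h'.bound
  have hC'0 : 0 ≤ C' := by simpa using (norm_nonneg _).trans (hC' 0 (by simp))
  refine ⟨fun z hz => (h.1 z hz).mul (h'.1 z hz), C * C', fun z hz => ?_⟩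
  rw [norm_mul, mul_div_right_comm]
  have h1 : (1 : ℝ) ≤ 1 + ‖z‖ := by linarith [norm_nonneg z]
  exact mul_le_mul (hC z hz) ((hC' z hz).trans (div_le_self hC'0 h1)) (norm_nonneg _)
    ((norm_nonneg _).trans (hC z hz))

/-- Decay 1/(1 + |z|) alone is too weak to close the contour; two such factors give 1/(1 + |z|²). -/
lemma integral_mul_eq_zero (h : UpperDecay Ψ) (h' : UpperDecay Ψ') :
    ∫ x : ℝ, Ψ x * Ψ' x = 0 := by
  obtain ⟨C, hC⟩ := h.bound
  obtain ⟨C', hC'⟩ := h'.bound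
  have hC0 : 0 ≤ C := by simpa using (norm_nonneg _).trans (hC 0 (by simp))
  have hC'0 : 0 ≤ C' := by simpa using (norm_nonneg _).trans (hC' 0 (by simp))
  refine integral_eq_zero_of_upperHalfPlane_decay (Ψ := fun z => Ψ z * Ψ' z) (C := C * C')
    (fun z hz => (h.1 z hz).mul (h'.1 z hz)) fun z hz => ?_
  rw [norm_mul]
  refine (mul_le_mul (hC z hz) (hC' z hz) (norm_nonneg _)
    ((norm_nonneg _).trans (hC z hz))).trans ?_
  rw [div_mul_div_comm]
  exact div_le_div_of_nonneg_left (by positivity) (by positivity) (by nlinarith [norm_nonneg z])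

lemma continuous (h : UpperDecay Ψ) : Continuous fun x : ℝ => Ψ x :=
  continuous_iff_continuousAt.2 fun x => ContinuousAt.comp (f := fun x : ℝ => (x : ℂ))
    (h.1 x (by simp)).continuousAt Complex.continuous_ofReal.continuousAt

lemma memLp (h : UpperDecay Ψ) : MemLp (fun x : ℝ => Ψ x) 2 := by
  obtain ⟨C, hC⟩ := h.bound
  rw [memLp_two_iff_integrable_sq_norm h.continuous.aestronglyMeasurable]
  refine Integrable.mono' (integrable_inv_one_add_sq.const_mul (C ^ 2))
    (h.continuous.norm.pow 2).aestronglyMeasurable (ae_of_all _ fun x => ?_)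
  rw [Real.norm_of_nonneg (sq_nonneg _)]
  refine (pow_le_pow_left₀ (norm_nonneg _) (hC x (by simp)) 2).trans ?_
  rw [div_pow, div_eq_mul_inv]
  refine mul_le_mul_of_nonneg_left (inv_anti₀ (by positivity) ?_) (sq_nonneg C)
  simp only [Complex.norm_real, Real.norm_eq_abs]
  nlinarith [abs_nonneg x, sq_abs x]

/-- Real part of ∫ Ψ² = 0. This replaces the Fourier proof that the Hilbert transform is an L²
isometry. -/
lemma eLpNorm_re_eq (h : UpperDecay Ψ) :
    eLpNorm (fun x : ℝ => (Ψ x).re) 2 volume = eLpNorm (fun x : ℝ => (Ψ x).im) 2 volume := by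
  have hre : MemLp (fun x : ℝ => (Ψ x).re) 2 := h.memLp.re
  have him : MemLp (fun x : ℝ => (Ψ x).im) 2 := h.memLp.im
  have h0 := congrArg Complex.re (h.integral_mul_eq_zero h)
  rw [← RCLike.re_eq_complex_re, ← integral_re] at h0
  · simp only [RCLike.re_eq_complex_re, Complex.mul_re, Complex.zero_re] at h0
    simp_rw [← pow_two] at h0
    rw [integral_sub hre.integrable_sq him.integrable_sq, sub_eq_zero] at h0
    rw [hre.eLpNorm_eq_integral_rpow_norm (by simp) (by simp),
      him.eLpNorm_eq_integral_rpow_norm (by simp) (by simp)]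
    simp [h0]
  · exact h.memLp.integrable_mul h.memLp

end UpperDecay

/-- The pole x - ih is below the real axis. The constant comes from |z - x + ih| ≥ h and |z| ≤ |z -
x + ih| + |x| + h. -/
lemma upperDecay_inv {h : ℝ} (hh : 0 < h) (x : ℝ) :
    UpperDecay fun z : ℂ => (z - x + h * Complex.I)⁻¹ := by
  have him : ∀ z : ℂ, 0 ≤ z.im → h ≤ ‖z - x + h * Complex.I‖ := fun z hz => by
    have := Complex.abs_im_le_norm (z - x + h * Complex.I)
    simp only [Complex.add_im, Complex.sub_im, Complex.ofReal_im, Complex.mul_im,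
      Complex.ofReal_re, Complex.I_im, mul_one, Complex.I_re, mul_zero, add_zero, sub_zero] at this
    exact (by linarith : h ≤ z.im + h).trans ((le_abs_self _).trans this)
  refine ⟨fun z hz => ?_, (1 + |x| + h) / h + 1, fun z hz => ?_⟩
  · refine DifferentiableAt.inv (by fun_prop) fun h0 => ?_
    have := him z hz
    rw [h0, norm_zero] at this
    linarith
  · have h1 := him z hz
    have h2 : ‖z‖ ≤ ‖z - x + h * Complex.I‖ + (|x| + h) := by
      calc ‖z‖ = ‖(z - x + h * Complex.I) + (x - h * Complex.I)‖ := by ring_nf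
        _ ≤ _ := (norm_add_le _ _).trans (add_le_add_right ((norm_sub_le _ _).trans (by
          simp [abs_of_pos hh])) _)
    rw [norm_inv, inv_eq_one_div, div_le_div_iff₀ (hh.trans_le h1) (by positivity)]
    have h3 : (1 + |x| + h) / h * h = 1 + |x| + h := by field_simp
    have h4 : 0 ≤ (1 + |x| + h) / h := by positivity
    nlinarith [mul_le_mul_of_nonneg_left h1 h4]

/-- The Cauchy transform of `f`, without the usual factor. -/
noncomputable def cauchyTransform (f : ℝ → ℝ) (z : ℂ) : ℂ := ∫ t : ℝ, (f t : ℂ) / (z - t)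

lemma im_le_norm_sub_ofReal (z : ℂ) (t : ℝ) : z.im ≤ ‖z - t‖ := by
  simpa using (le_abs_self _).trans (Complex.abs_im_le_norm (z - t))

lemma sub_ofReal_ne_zero {z : ℂ} (hz : 0 < z.im) (t : ℝ) : z - t ≠ 0 :=
  norm_pos_iff.1 (hz.trans_le (im_le_norm_sub_ofReal z t))

section

variable {f : ℝ → ℝ} (hf : Continuous f) (hfs : HasCompactSupport f)

include hf hfs

lemma differentiableAt_cauchyTransform {z : ℂ} (hz : 0 < z.im) :
    DifferentiableAt ℂ (cauchyTransform f) z := by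
  have hi : Integrable f := hf.integrable_of_hasCompactSupport hfs
  have hnear : ∀ w ∈ {w : ℂ | z.im / 2 < w.im}, 0 < w.im := fun w hw => by
    have : z.im / 2 < w.im := hw
    linarith
  have hcont : ∀ w : ℂ, 0 < w.im → Continuous fun t : ℝ => (f t : ℂ) / (w - t) := fun w hw =>
    (Complex.continuous_ofReal.comp hf).div (by fun_prop) (sub_ofReal_ne_zero hw)
  have hs : {w : ℂ | z.im / 2 < w.im} ∈ 𝓝 z :=
    (isOpen_lt continuous_const Complex.continuous_im).mem_nhds
      (by simp only [mem_ofPred_eq]; linarith)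
  refine (hasDerivAt_integral_of_dominated_loc_of_deriv_le (𝕜 := ℂ) (μ := volume)
    (F := fun w t => (f t : ℂ) / (w - t))
    (F' := fun w t => -((f t : ℂ) / (w - t) ^ 2)) (s := {w : ℂ | z.im / 2 < w.im})
    (bound := fun t => ‖f t‖ * ((z.im / 2) ^ 2)⁻¹) hs ?_ ?_ ?_ (ae_of_all _ fun t w hw => ?_)
    (hi.norm.mul_const _) (ae_of_all _ fun t w hw => ?_)).2.differentiableAt
  · filter_upwards [hs] with w hw using (hcont w (hnear w hw)).aestronglyMeasurable
  · refine Integrable.mono' (hi.norm.mul_const z.im⁻¹) (hcont z hz).aestronglyMeasurable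
      (ae_of_all _ fun t => ?_)
    rw [norm_div, Complex.norm_real, div_eq_mul_inv]
    exact mul_le_mul_of_nonneg_left (inv_anti₀ hz (im_le_norm_sub_ofReal z t)) (norm_nonneg _)
  · exact ((Complex.continuous_ofReal.comp hf).div (by fun_prop)
      fun t => pow_ne_zero 2 (sub_ofReal_ne_zero hz t)).neg.aestronglyMeasurable
  · rw [norm_neg, norm_div, Complex.norm_real, norm_pow, div_eq_mul_inv]
    have hw' : z.im / 2 < w.im := hw
    have := im_le_norm_sub_ofReal w t
    exact mul_le_mul_of_nonneg_left (inv_anti₀ (by positivity)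
      (pow_le_pow_left₀ (by positivity) (by linarith) 2)) (norm_nonneg _)
  · have h1 : HasDerivAt (fun w : ℂ => w - (t : ℂ)) 1 w := (hasDerivAt_id w).sub_const _
    have h2 := (h1.inv (sub_ofReal_ne_zero (hnear w hw) t)).const_mul (f t : ℂ)
    exact (h2.congr_deriv (by ring)).congr_of_eventuallyEq
      (Eventually.of_forall fun y => div_eq_mul_inv _ _)

lemma norm_cauchyTransform_le {k : ℝ} (hk : 0 < k) :
    ∃ C : ℝ, ∀ z : ℂ, k ≤ z.im → ‖cauchyTransform f z‖ ≤ C / (1 + ‖z‖) := by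
  have hi : Integrable f := hf.integrable_of_hasCompactSupport hfs
  obtain ⟨M, hM⟩ := hfs.isCompact.isBounded.exists_norm_le
  refine ⟨∫ t, ‖f t‖ * ((1 + |M|) / k + 1), fun z hz => ?_⟩
  rw [← integral_div]
  refine norm_integral_le_of_norm_le ((hi.norm.mul_const _).div_const _)
    (ae_of_all _ fun t => ?_)
  by_cases ht : t ∈ tsupport f
  · have h1 : k ≤ ‖z - t‖ := hz.trans (im_le_norm_sub_ofReal z t)
    have h2 : ‖z‖ ≤ ‖z - t‖ + |M| := by
      calc ‖z‖ = ‖(z - t) + t‖ := by ring_nf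
        _ ≤ ‖z - t‖ + ‖(t : ℂ)‖ := norm_add_le _ _
        _ ≤ _ := by
          rw [Complex.norm_real]
          linarith [hM t ht, le_abs_self M]
    rw [norm_div, Complex.norm_real, div_le_div_iff₀ (hk.trans_le h1) (by positivity), mul_assoc]
    refine mul_le_mul_of_nonneg_left ?_ (norm_nonneg _)
    have h3 : (1 + |M|) / k * k = 1 + |M| := by field_simp
    have h4 : 0 ≤ (1 + |M|) / k := by positivity
    nlinarith [mul_le_mul_of_nonneg_left h1 h4]
  · simp [image_eq_zero_of_notMem_tsupport ht]

lemma upperDecay_cauchyTransform {k : ℝ} (hk : 0 < k) :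
    UpperDecay fun z => cauchyTransform f (z + k * Complex.I) := by
  have him : ∀ z : ℂ, (z + k * Complex.I).im = z.im + k := fun z => by simp
  obtain ⟨C, hC⟩ := norm_cauchyTransform_le hf hfs hk
  have hC0 : 0 ≤ C := by
    have := (norm_nonneg _).trans (hC (k * Complex.I) (by simp))
    by_contra hneg
    exact absurd this (not_le.2 (div_neg_of_neg_of_pos (not_le.1 hneg) (by positivity)))
  refine ⟨fun z hz => ?_, C, fun z hz => ?_⟩
  · exact DifferentiableAt.comp (g := cauchyTransform f) z
      (differentiableAt_cauchyTransform hf hfs (by rw [him]; linarith)) (by fun_prop)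
  · refine (hC _ (by rw [him]; linarith)).trans (div_le_div_of_nonneg_left hC0 (by positivity) ?_)
    gcongr
    rw [Complex.norm_def, Complex.norm_def]
    refine Real.sqrt_le_sqrt ?_
    simp only [Complex.normSq_apply, him]
    simp
    nlinarith

lemma cauchyTransform_eq {k : ℝ} (hk : 0 < k) (x : ℝ) :
    cauchyTransform f (x + k * Complex.I) = conjPoisson f k x - poisson f k x * Complex.I := by
  have hi : Integrable f := hf.integrable_of_hasCompactSupport hfs
  have h1 := integrable_mul_conjPoissonKernel_of_integrable hi hk x
  obtain ⟨M, hM⟩ := hfs.exists_bound_of_continuous hf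
  have h2 := integrable_mul_poissonKernel hf hM hk x
  rw [conjPoisson, poisson, cauchyTransform, ← integral_complex_ofReal, ← integral_complex_ofReal,
    ← integral_mul_const, ← integral_sub h1.ofReal (h2.ofReal.mul_const _)]
  congr 1
  ext t
  have hz : (x + k * Complex.I - t : ℂ) ≠ 0 := sub_ofReal_ne_zero (by simpa using hk) t
  have hp : (((x : ℂ) - t) ^ 2 + (k : ℂ) ^ 2) ≠ 0 := by
    exact_mod_cast (sq_add_sq_pos (x - t) hk).ne'
  push_cast
  field_simp
  linear_combination (f t : ℂ) * (k : ℂ) ^ 2 * (Complex.I_sq)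

end

lemma exists_seq_tendsto_zero : ∃ u : ℕ → ℝ, (∀ n, 0 < u n) ∧ Tendsto u atTop (𝓝[>] 0) :=
  ⟨fun n => 1 / ((n : ℝ) + 1), fun n => Nat.one_div_pos_of_nat (n := n), tendsto_nhdsWithin_iff.2
    ⟨tendsto_one_div_add_atTop_nhds_zero_nat,
      Eventually.of_forall fun n => mem_Ioi.2 (Nat.one_div_pos_of_nat (n := n))⟩⟩

/-! ### L² limits of the Poisson and conjugate Poisson integrals. -/

section

variable {f : ℝ → ℝ} (hf : Continuous f) (hfs : HasCompactSupport f)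

include hf hfs

lemma re_cauchyTransform {k : ℝ} (hk : 0 < k) (x : ℝ) :
    (cauchyTransform f (x + k * Complex.I)).re = conjPoisson f k x := by
  simp [cauchyTransform_eq hf hfs hk]

lemma im_cauchyTransform {k : ℝ} (hk : 0 < k) (x : ℝ) :
    (cauchyTransform f (x + k * Complex.I)).im = -poisson f k x := by
  simp [cauchyTransform_eq hf hfs hk]

lemma memLp_conjPoisson {k : ℝ} (hk : 0 < k) : MemLp (conjPoisson f k) 2 := by
  have : MemLp (fun x : ℝ => (cauchyTransform f (x + k * Complex.I)).re) 2 :=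
    (upperDecay_cauchyTransform hf hfs hk).memLp.re
  simpa only [re_cauchyTransform hf hfs hk] using this

lemma memLp_poisson {k : ℝ} (hk : 0 < k) : MemLp (poisson f k) 2 := by
  have : MemLp (fun x : ℝ => (cauchyTransform f (x + k * Complex.I)).im) 2 :=
    (upperDecay_cauchyTransform hf hfs hk).memLp.im
  simp only [im_cauchyTransform hf hfs hk] at this
  exact (memLp_neg_iff (f := poisson f k)).1 this

lemma eLpNorm_conjPoisson_eq {k : ℝ} (hk : 0 < k) :
    eLpNorm (conjPoisson f k) 2 volume = eLpNorm (poisson f k) 2 volume := by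
  have := (upperDecay_cauchyTransform hf hfs hk).eLpNorm_re_eq
  simp only [re_cauchyTransform hf hfs hk, im_cauchyTransform hf hfs hk] at this
  exact this.trans (eLpNorm_neg (poisson f k) 2 volume)

/-- The isometry for a difference of two heights: it transfers the Cauchy property in L² from the
Poisson to the conjugate Poisson integrals. -/
lemma eLpNorm_conjPoisson_sub_eq {k l : ℝ} (hk : 0 < k) (hl : 0 < l) :
    eLpNorm (conjPoisson f k - conjPoisson f l) 2 volume
      = eLpNorm (poisson f k - poisson f l) 2 volume := by
  have := ((upperDecay_cauchyTransform hf hfs hk).sub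
    (upperDecay_cauchyTransform hf hfs hl)).eLpNorm_re_eq
  simp only [Complex.sub_re, Complex.sub_im, re_cauchyTransform hf hfs hk,
    re_cauchyTransform hf hfs hl, im_cauchyTransform hf hfs hk,
    im_cauchyTransform hf hfs hl] at this
  refine this.trans ?_
  rw [← eLpNorm_neg (poisson f k - poisson f l)]
  congr 1
  ext x
  simp
  ring

/-- A majorant uniform in the height, for dominated convergence in L². On |y| ≤ M the weight
satisfies 1 + x² ≤ (1 + 2M²) + 2((x - y)² + k²), and the last bracket cancels the denominator of the
kernel. -/
lemma abs_poisson_le_decay : ∃ B : ℝ, ∀ k x : ℝ, 0 < k → k ≤ 1 →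
    |poisson f k x| ≤ B * (1 + x ^ 2)⁻¹ := by
  have hi : Integrable f := hf.integrable_of_hasCompactSupport hfs
  obtain ⟨M, hM⟩ := hfs.isCompact.isBounded.exists_norm_le
  obtain ⟨N, hN⟩ := hfs.exists_bound_of_continuous hf
  refine ⟨(1 + 2 * M ^ 2) * (Real.pi * N) + 2 * ∫ y, |f y|, fun k x hk hk1 => ?_⟩
  have e1 : |poisson f k x| * (1 + x ^ 2)
      = ‖∫ y, f y * (k / ((x - y) ^ 2 + k ^ 2)) * (1 + x ^ 2)‖ := by
    rw [integral_mul_const, norm_mul, Real.norm_of_nonneg (by positivity : 0 ≤ 1 + x ^ 2)]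
    rfl
  have e2 : (1 + 2 * M ^ 2) * (Real.pi * N) + 2 * ∫ y, |f y|
      = ∫ y, ((1 + 2 * M ^ 2) * (N * (k / ((x - y) ^ 2 + k ^ 2))) + 2 * |f y|) := by
    rw [integral_add (((integrable_poissonKernel_sub hk x).const_mul _).const_mul _)
      (hi.abs.const_mul 2), integral_const_mul, integral_const_mul, integral_const_mul,
      integral_poissonKernel_sub hk x, mul_comm N]
  rw [← div_eq_mul_inv, le_div_iff₀ (by positivity), e1, e2]
  refine norm_integral_le_of_norm_le
    ((((integrable_poissonKernel_sub hk x).const_mul _).const_mul _).add (hi.abs.const_mul 2))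
    (ae_of_all _ fun y => ?_)
  have hp := poissonKernel_nonneg (x - y) hk
  rw [Real.norm_eq_abs, abs_mul, abs_mul, abs_of_nonneg hp,
    abs_of_nonneg (by positivity : 0 ≤ 1 + x ^ 2)]
  by_cases hy : y ∈ tsupport f
  · have hy2 : y ^ 2 ≤ M ^ 2 := sq_le_sq' (by linarith [neg_abs_le y, hM y hy, Real.norm_eq_abs y])
      ((le_abs_self y).trans (hM y hy))
    have h1 : (1 + x ^ 2) * (k / ((x - y) ^ 2 + k ^ 2))
        ≤ (1 + 2 * M ^ 2) * (k / ((x - y) ^ 2 + k ^ 2)) + 2 := by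
      have hx : 1 + x ^ 2 ≤ (1 + 2 * M ^ 2) + 2 * ((x - y) ^ 2 + k ^ 2) := by
        nlinarith [sq_nonneg (x - 2 * y), sq_nonneg k]
      have h3 : ((x - y) ^ 2 + k ^ 2) * (k / ((x - y) ^ 2 + k ^ 2)) = k :=
        mul_div_cancel₀ _ (sq_add_sq_pos _ hk).ne'
      nlinarith [mul_le_mul_of_nonneg_right hx hp]
    have h4 : |f y| ≤ N := hN y
    have h5 : 0 ≤ (1 + 2 * M ^ 2) * (k / ((x - y) ^ 2 + k ^ 2)) := by positivity
    nlinarith [mul_le_mul_of_nonneg_left h1 (abs_nonneg (f y)), mul_le_mul_of_nonneg_right h4 h5]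
  · have hN0 : 0 ≤ N := (norm_nonneg _).trans (hN 0)
    rw [image_eq_zero_of_notMem_tsupport hy]
    simp
    positivity

lemma tendsto_eLpNorm_poisson_sub :
    Tendsto (fun k => eLpNorm (poisson f k - fun x => Real.pi * f x) 2 volume) (𝓝[>] 0) (𝓝 0) := by
  obtain ⟨N, hN⟩ := hfs.exists_bound_of_continuous hf
  obtain ⟨B, hB⟩ := abs_poisson_le_decay hf hfs
  have hk1 : ∀ᶠ k : ℝ in 𝓝[>] 0, k ≤ 1 :=
    nhdsWithin_le_nhds (Iic_mem_nhds one_pos)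
  have hlim : ∀ x, Tendsto (fun k => poisson f k x) (𝓝[>] 0) (𝓝 (Real.pi * f x)) :=
    tendsto_poisson hf hN
  have hfB : ∀ x, |Real.pi * f x| ≤ B * (1 + x ^ 2)⁻¹ := fun x => by
    refine le_of_tendsto (hlim x).abs ?_
    filter_upwards [hk1, self_mem_nhdsWithin] with k hk hk0 using hB k x hk0 hk
  have hfm : MemLp (fun x => Real.pi * f x) 2 :=
    (hf.memLp_of_hasCompactSupport hfs).const_mul _
  have key : Tendsto (fun k => ∫ x, (poisson f k x - Real.pi * f x) ^ 2) (𝓝[>] 0)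
      (𝓝 (∫ _ : ℝ, (0 : ℝ))) := by
    refine tendsto_integral_filter_of_dominated_convergence
      (fun x => (2 * B) ^ 2 * (1 + x ^ 2)⁻¹) ?_ ?_ (integrable_inv_one_add_sq.const_mul _)
      (ae_of_all _ fun x => ?_)
    · filter_upwards [self_mem_nhdsWithin] with k hk
      exact ((memLp_poisson hf hfs hk).sub hfm).integrable_sq.aestronglyMeasurable
    · filter_upwards [hk1, self_mem_nhdsWithin] with k hk hk0
      refine ae_of_all _ fun x => ?_
      rw [Real.norm_of_nonneg (sq_nonneg _), ← sq_abs]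
      have h1 : |poisson f k x - Real.pi * f x| ≤ 2 * B * (1 + x ^ 2)⁻¹ := by
        linarith [abs_sub (poisson f k x) (Real.pi * f x), hB k x hk0 hk, hfB x]
      refine (pow_le_pow_left₀ (abs_nonneg _) h1 2).trans ?_
      rw [mul_pow]
      refine mul_le_mul_of_nonneg_left ?_ (sq_nonneg _)
      have h2 : (1 + x ^ 2)⁻¹ ≤ 1 := inv_le_one_of_one_le₀ (by nlinarith [sq_nonneg x])
      have h3 : 0 ≤ (1 + x ^ 2)⁻¹ := by positivity
      nlinarith
    · have := ((hlim x).sub_const (Real.pi * f x)).pow 2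
      simpa using this
  rw [integral_zero] at key
  have key2 := ENNReal.tendsto_ofReal (key.rpow_const (p := 2⁻¹) (Or.inr (by norm_num)))
  rw [Real.zero_rpow (by norm_num), ENNReal.ofReal_zero] at key2
  refine key2.congr' ?_
  filter_upwards [self_mem_nhdsWithin] with k hk
  rw [((memLp_poisson hf hfs hk).sub hfm).eLpNorm_eq_integral_rpow_norm (by simp) (by simp)]
  simp

variable {F : ℝ → ℝ}
  (hF : ∀ᵐ x, Tendsto (fun h => conjPoisson f h x) (𝓝[>] 0) (𝓝 (Real.pi * F x)))

include hF

/-- Fatou along heights tending to 0 identifies the L² limit with the a.e. limit πF; the isometry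
and the triangle inequality through πf bound the lower limit. -/
lemma eLpNorm_conjPoisson_sub_le {k : ℝ} (hk : 0 < k) :
    eLpNorm (conjPoisson f k - fun x => Real.pi * F x) 2 volume
      ≤ eLpNorm (poisson f k - fun x => Real.pi * f x) 2 volume := by
  obtain ⟨u, hu, hu0⟩ := exists_seq_tendsto_zero
  have h1 := Lp.eLpNorm_lim_le_liminf_eLpNorm (μ := volume) (p := 2)
    (f := fun n => conjPoisson f k - conjPoisson f (u n))
    (fun n => ((memLp_conjPoisson hf hfs hk).sub (memLp_conjPoisson hf hfs (hu n))).1)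
    (conjPoisson f k - fun x => Real.pi * F x)
    (hF.mono fun x hx => (hx.comp hu0).const_sub _)
  refine h1.trans ?_
  have hfm : MemLp (fun x => Real.pi * f x) 2 :=
    (hf.memLp_of_hasCompactSupport hfs).const_mul _
  have h2 : Tendsto (fun n => eLpNorm (poisson f k - fun x => Real.pi * f x) 2 volume
      + eLpNorm (poisson f (u n) - fun x => Real.pi * f x) 2 volume) atTop
      (𝓝 (eLpNorm (poisson f k - fun x => Real.pi * f x) 2 volume)) := by
    simpa using ((tendsto_eLpNorm_poisson_sub hf hfs).comp hu0).const_add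
      (eLpNorm (poisson f k - fun x => Real.pi * f x) 2 volume)
  rw [← h2.liminf_eq]
  refine liminf_le_liminf (Eventually.of_forall fun n => ?_)
  rw [eLpNorm_conjPoisson_sub_eq hf hfs hk (hu n)]
  have h3 : poisson f k - poisson f (u n) = (poisson f k - fun x => Real.pi * f x)
      - (poisson f (u n) - fun x => Real.pi * f x) := by abel
  rw [h3]
  exact eLpNorm_sub_le ((memLp_poisson hf hfs hk).sub hfm).1
    ((memLp_poisson hf hfs (hu n)).sub hfm).1 (by norm_num)

lemma tendsto_eLpNorm_conjPoisson_sub :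
    Tendsto (fun k => eLpNorm (conjPoisson f k - fun x => Real.pi * F x) 2 volume)
      (𝓝[>] 0) (𝓝 0) := by
  refine tendsto_of_tendsto_of_tendsto_of_le_of_le' tendsto_const_nhds
    (tendsto_eLpNorm_poisson_sub hf hfs) (Eventually.of_forall fun _ => zero_le) ?_
  filter_upwards [self_mem_nhdsWithin] with k hk using eLpNorm_conjPoisson_sub_le hf hfs hF hk

lemma eLpNorm_le_of_tendsto_conjPoisson : eLpNorm F 2 volume ≤ eLpNorm f 2 volume := by
  obtain ⟨u, hu, hu0⟩ := exists_seq_tendsto_zero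
  have h1 := Lp.eLpNorm_lim_le_liminf_eLpNorm (μ := volume) (p := 2)
    (f := fun n => conjPoisson f (u n)) (fun n => (memLp_conjPoisson hf hfs (hu n)).1)
    (fun x => Real.pi * F x) (hF.mono fun x hx => hx.comp hu0)
  have hfm : MemLp (fun x => Real.pi * f x) 2 :=
    (hf.memLp_of_hasCompactSupport hfs).const_mul _
  have h2 : Tendsto (fun n => eLpNorm (fun x => Real.pi * f x) 2 volume
      + eLpNorm (poisson f (u n) - fun x => Real.pi * f x) 2 volume) atTop
      (𝓝 (eLpNorm (fun x => Real.pi * f x) 2 volume)) := by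
    simpa using ((tendsto_eLpNorm_poisson_sub hf hfs).comp hu0).const_add
      (eLpNorm (fun x => Real.pi * f x) 2 volume)
  have h3 : eLpNorm (fun x => Real.pi * F x) 2 volume ≤ eLpNorm (fun x => Real.pi * f x) 2 volume := by
    refine h1.trans ?_
    rw [← h2.liminf_eq]
    refine liminf_le_liminf (Eventually.of_forall fun n => ?_)
    rw [eLpNorm_conjPoisson_eq hf hfs (hu n)]
    have h4 : poisson f (u n) = (fun x => Real.pi * f x)
      + (poisson f (u n) - fun x => Real.pi * f x) := by abel
    conv_lhs => rw [h4]
    exact eLpNorm_add_le hfm.1 ((memLp_poisson hf hfs (hu n)).sub hfm).1 (by norm_num)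
  have h5 : ∀ w : ℝ → ℝ, eLpNorm (fun x => Real.pi * w x) 2 volume
      = ‖Real.pi‖ₑ * eLpNorm w 2 volume := fun w => eLpNorm_const_smul Real.pi w 2 volume
  rw [h5, h5] at h3
  exact (ENNReal.mul_le_mul_iff_right (by simp [Real.pi_ne_zero]) (by simp)).1 h3

end

/-- Convergence in `L²` passes to integrals against a fixed function of `L²`. -/
lemma tendsto_integral_mul_of_tendsto_eLpNorm {ι : Type*} {l : Filter ι} {W : ι → ℝ → ℂ}
    {V m : ℝ → ℂ} (hW : ∀ᶠ i in l, MemLp (W i) 2) (hV : MemLp V 2) (hm : MemLp m 2)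
    (hWV : Tendsto (fun i => eLpNorm (W i - V) 2 volume) l (𝓝 0)) :
    Tendsto (fun i => ∫ x, W i x * m x) l (𝓝 (∫ x, V x * m x)) := by
  refine tendsto_integral_of_L1' (fun x => V x * m x) (hV.1.mul hm.1)
    (hW.mono fun i hi => hi.integrable_mul hm) ?_
  have h1 : Tendsto (fun i => eLpNorm (W i - V) 2 volume * eLpNorm m 2 volume) l (𝓝 0) := by
    simpa using ENNReal.Tendsto.mul_const hWV (Or.inr hm.2.ne)
  refine tendsto_of_tendsto_of_tendsto_of_le_of_le' tendsto_const_nhds h1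
    (Eventually.of_forall fun _ => zero_le) (hW.mono fun i hi => ?_)
  have h2 : ((fun x => W i x * m x) - fun x => V x * m x) = (W i - V) • m := by
    ext x
    simp [sub_mul]
  rw [h2]
  exact eLpNorm_smul_le_mul_eLpNorm hm.1 (hi.sub hV).1

/-- Products of functions converging in `L²` converge against a fixed bounded function. -/
lemma tendsto_integral_mul_mul_of_tendsto_eLpNorm {ι : Type*} {l : Filter ι} {W W' : ι → ℝ → ℂ}
    {V V' m : ℝ → ℂ} (hW : ∀ᶠ i in l, MemLp (W i) 2) (hV : MemLp V 2)
    (hW' : ∀ᶠ i in l, MemLp (W' i) 2) (hV' : MemLp V' 2)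
    (hm : AEStronglyMeasurable m) {B : ℝ} (hB : ∀ x, ‖m x‖ ≤ B)
    (hWV : Tendsto (fun i => eLpNorm (W i - V) 2 volume) l (𝓝 0))
    (hWV' : Tendsto (fun i => eLpNorm (W' i - V') 2 volume) l (𝓝 0)) :
    Tendsto (fun i => ∫ x, W i x * W' i x * m x) l (𝓝 (∫ x, V x * V' x * m x)) := by
  refine tendsto_integral_of_L1' (fun x => V x * V' x * m x) ((hV.1.mul hV'.1).mul hm) ?_ ?_
  · filter_upwards [hW, hW'] with i hi hi'
    exact (hi.integrable_mul hi').mul_bdd hm (Eventually.of_forall hB)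
  have h1 : Tendsto (fun i => ENNReal.ofReal B *
      (eLpNorm (W i - V) 2 volume * eLpNorm (W' i - V') 2 volume
        + eLpNorm (W i - V) 2 volume * eLpNorm V' 2 volume
        + eLpNorm V 2 volume * eLpNorm (W' i - V') 2 volume)) l (𝓝 0) := by
    have a1 := ENNReal.Tendsto.mul hWV (Or.inr (by simp)) hWV' (Or.inr (by simp))
    have a2 := ENNReal.Tendsto.mul_const hWV (Or.inr hV'.2.ne)
    have a3 := ENNReal.Tendsto.const_mul hWV' (Or.inr hV.2.ne)
    simpa using ENNReal.Tendsto.const_mul ((a1.add a2).add a3)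
      (Or.inr (ENNReal.ofReal_ne_top (r := B)))
  refine tendsto_of_tendsto_of_tendsto_of_le_of_le' tendsto_const_nhds h1
    (Eventually.of_forall fun _ => zero_le) ?_
  filter_upwards [hW, hW'] with i hi hi'
  have hs := hi.sub hV
  have hs' := hi'.sub hV'
  have h2 : eLpNorm ((fun x => W i x * W' i x * m x) - fun x => V x * V' x * m x) 1 volume
      ≤ ENNReal.ofReal B * eLpNorm ((W i - V) • (W' i - V') + (W i - V) • V'
        + V • (W' i - V')) 1 volume := by
    refine eLpNorm_le_mul_eLpNorm_of_ae_le_mul (ae_of_all _ fun x => ?_) 1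
    -- Expanding around the limits leaves only products with at least one factor tending to 0 in L²,
    -- and Hölder applies to each.
    have h3 : W i x * W' i x * m x - V x * V' x * m x
        = m x * ((W i x - V x) * (W' i x - V' x) + (W i x - V x) * V' x
          + V x * (W' i x - V' x)) := by ring
    simp only [Pi.sub_apply, Pi.add_apply, smul_eq_mul]
    rw [h3, norm_mul]
    exact mul_le_mul_of_nonneg_right (hB x) (norm_nonneg _)
  refine h2.trans (mul_le_mul_right ?_ _)
  have m1 := hs.1.smul hs'.1
  have m2 := hs.1.smul hV'.1
  have m3 := hV.1.smul hs'.1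
  refine (eLpNorm_add_le (m1.add m2) m3 le_rfl).trans (add_le_add
    ((eLpNorm_add_le m1 m2 le_rfl).trans (add_le_add ?_ ?_)) ?_)
  · exact eLpNorm_smul_le_mul_eLpNorm hs'.1 hs.1
  · exact eLpNorm_smul_le_mul_eLpNorm hV'.1 hs.1
  · exact eLpNorm_smul_le_mul_eLpNorm hs'.1 hV.1

/-- `F` is the (continuous, a.e. defined) boundary value of the conjugate Poisson integral of the
continuous compactly supported function `f`. -/
structure IsConjugate (f F : ℝ → ℝ) : Prop where
  cont : Continuous f
  supp : HasCompactSupport f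
  cont_conj : Continuous F
  bdd_conj : ∃ M, ∀ x, |F x| ≤ M
  tendsto : ∀ᵐ x, Tendsto (fun h => conjPoisson f h x) (𝓝[>] 0) (𝓝 (Real.pi * F x))

/-- The boundary value of the Cauchy transform. -/
noncomputable def boundaryValue (f F : ℝ → ℝ) (x : ℝ) : ℂ := Real.pi * (F x - f x * Complex.I)

namespace IsConjugate

variable {f F g G : ℝ → ℝ}

lemma memLp_left (hf : IsConjugate f F) : MemLp f 2 := hf.cont.memLp_of_hasCompactSupport hf.supp

lemma memLp (hf : IsConjugate f F) : MemLp F 2 :=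
  ⟨hf.cont_conj.aestronglyMeasurable, (eLpNorm_le_of_tendsto_conjPoisson hf.cont hf.supp
    hf.tendsto).trans_lt hf.memLp_left.2⟩

lemma integral_sq_le (hf : IsConjugate f F) : ∫ x, F x ^ 2 ≤ ∫ x, f x ^ 2 := by
  have h := eLpNorm_le_of_tendsto_conjPoisson hf.cont hf.supp hf.tendsto
  rw [hf.memLp.eLpNorm_eq_integral_rpow_norm (by simp) (by simp),
    hf.memLp_left.eLpNorm_eq_integral_rpow_norm (by simp) (by simp),
    ENNReal.ofReal_le_ofReal_iff (by positivity)] at h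
  simp only [ENNReal.toReal_ofNat, Real.rpow_ofNat, Real.norm_eq_abs, sq_abs] at h
  exact (Real.rpow_le_rpow_iff (integral_nonneg fun x => sq_nonneg _)
    (integral_nonneg fun x => sq_nonneg _) (by norm_num)).1 h

lemma memLp_boundaryValue (hf : IsConjugate f F) : MemLp (boundaryValue f F) 2 := by
  have h1 : MemLp (fun x => (F x : ℂ)) 2 := hf.memLp.ofReal
  have h2 : MemLp (fun x => (f x : ℂ)) 2 := hf.memLp_left.ofReal
  exact (h1.sub (h2.mul_const Complex.I)).const_mul _

lemma memLp_cauchyTransform (hf : IsConjugate f F) {k : ℝ} (hk : 0 < k) :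
    MemLp (fun x : ℝ => cauchyTransform f (x + k * Complex.I)) 2 :=
  (upperDecay_cauchyTransform hf.cont hf.supp hk).memLp

lemma tendsto_eLpNorm_sub (hf : IsConjugate f F) :
    Tendsto (fun k : ℝ => eLpNorm ((fun x : ℝ => cauchyTransform f (x + k * Complex.I))
      - boundaryValue f F) 2 volume) (𝓝[>] 0) (𝓝 0) := by
  have h1 := (tendsto_eLpNorm_conjPoisson_sub hf.cont hf.supp hf.tendsto).add
    (tendsto_eLpNorm_poisson_sub hf.cont hf.supp)
  rw [add_zero] at h1
  refine tendsto_of_tendsto_of_tendsto_of_le_of_le' tendsto_const_nhds h1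
    (Eventually.of_forall fun _ => zero_le) ?_
  filter_upwards [self_mem_nhdsWithin] with k hk
  have hv := (memLp_conjPoisson hf.cont hf.supp hk).sub (hf.memLp.const_mul Real.pi)
  have hu := (memLp_poisson hf.cont hf.supp hk).sub (hf.memLp_left.const_mul Real.pi)
  have e : ((fun x : ℝ => cauchyTransform f (x + k * Complex.I)) - boundaryValue f F)
      = (fun x => ((conjPoisson f k x - Real.pi * F x : ℝ) : ℂ))
        - fun x => ((poisson f k x - Real.pi * f x : ℝ) : ℂ) * Complex.I := by
    ext x
    simp only [Pi.sub_apply, cauchyTransform_eq hf.cont hf.supp hk, boundaryValue]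
    push_cast
    ring
  rw [e]
  refine (eLpNorm_sub_le hv.ofReal.1 (hu.ofReal.1.mul_const _) (by norm_num)).trans
    (add_le_add (le_of_eq ?_) (le_of_eq ?_))
  · exact eLpNorm_congr_norm_ae (ae_of_all _ fun x => Complex.norm_real _)
  · refine eLpNorm_congr_norm_ae (ae_of_all _ fun x => ?_)
    rw [norm_mul, Complex.norm_I, mul_one, Complex.norm_real]
    rfl

lemma integral_boundaryValue_mul (hf : IsConjugate f F) {h : ℝ} (hh : 0 < h) (x : ℝ) :
    ∫ t, boundaryValue f F t * (t - x + h * Complex.I)⁻¹ = 0 := by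
  refine tendsto_nhds_unique (tendsto_integral_mul_of_tendsto_eLpNorm (l := 𝓝[>] (0 : ℝ))
    (eventually_mem_nhdsWithin.mono fun k hk => hf.memLp_cauchyTransform hk)
    hf.memLp_boundaryValue (upperDecay_inv hh x).memLp hf.tendsto_eLpNorm_sub) ?_
  refine tendsto_const_nhds.congr' (eventually_mem_nhdsWithin.mono fun k hk => ?_)
  exact ((upperDecay_cauchyTransform hf.cont hf.supp hk).integral_mul_eq_zero
    (upperDecay_inv hh x)).symm

lemma integral_boundaryValue_mul_mul (hf : IsConjugate f F) (hg : IsConjugate g G) {h : ℝ}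
    (hh : 0 < h) (x : ℝ) :
    ∫ t, boundaryValue f F t * boundaryValue g G t * (t - x + h * Complex.I)⁻¹ = 0 := by
  obtain ⟨C, hC⟩ := (upperDecay_inv hh x).bound
  have hC0 : 0 ≤ C := by simpa using (norm_nonneg _).trans (hC 0 (by simp))
  refine tendsto_nhds_unique (tendsto_integral_mul_mul_of_tendsto_eLpNorm (l := 𝓝[>] (0 : ℝ))
    (eventually_mem_nhdsWithin.mono fun k hk => hf.memLp_cauchyTransform hk)
    hf.memLp_boundaryValue
    (eventually_mem_nhdsWithin.mono fun k hk => hg.memLp_cauchyTransform hk)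
    hg.memLp_boundaryValue (upperDecay_inv hh x).memLp.1 (B := C) (fun t =>
      (hC t (by simp)).trans (div_le_self hC0 (by linarith [norm_nonneg (t : ℂ)])))
    hf.tendsto_eLpNorm_sub hg.tendsto_eLpNorm_sub) ?_
  refine tendsto_const_nhds.congr' (eventually_mem_nhdsWithin.mono fun k hk => ?_)
  exact (((upperDecay_cauchyTransform hf.cont hf.supp hk).mul
    (upperDecay_cauchyTransform hg.cont hg.supp hk)).integral_mul_eq_zero
    (upperDecay_inv hh x)).symm

end IsConjugate

/-! ### Conjugation identities at positive height. -/

lemma inv_sub_add_mul_I {h : ℝ} (hh : 0 < h) (x t : ℝ) :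
    ((t : ℂ) - x + h * Complex.I)⁻¹
      = ((-((x - t) / ((x - t) ^ 2 + h ^ 2)) : ℝ) : ℂ)
        - ((h / ((x - t) ^ 2 + h ^ 2) : ℝ) : ℂ) * Complex.I := by
  have hp : (((x : ℂ) - t) ^ 2 + (h : ℂ) ^ 2) ≠ 0 := by
    exact_mod_cast (sq_add_sq_pos (x - t) hh).ne'
  have hz : ((t : ℂ) - x + h * Complex.I) ≠ 0 := fun h0 => by
    have := congrArg Complex.im h0
    simp at this
    exact hh.ne' this
  push_cast
  field_simp
  linear_combination (h : ℂ) ^ 2 * Complex.I_sq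

namespace IsConjugate

variable {f F g G : ℝ → ℝ}

/-- A smoothed form of H² = -1: the real part of the vanishing pairing of the boundary value with
1/(t - x + ih). -/
lemma conjPoisson_eq (hf : IsConjugate f F) {h : ℝ} (hh : 0 < h) (x : ℝ) :
    conjPoisson F h x = -poisson f h x := by
  have h0 := congrArg Complex.re (hf.integral_boundaryValue_mul hh x)
  obtain ⟨N, hN⟩ := hf.supp.exists_bound_of_continuous hf.cont
  have hi : Integrable fun t => boundaryValue f F t * ((t : ℂ) - x + h * Complex.I)⁻¹ :=
    hf.memLp_boundaryValue.integrable_mul (upperDecay_inv hh x).memLp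
  rw [← RCLike.re_eq_complex_re, ← integral_re hi] at h0
  have e : ∀ t, RCLike.re (boundaryValue f F t * (t - x + h * Complex.I)⁻¹)
      = -Real.pi * (F t * ((x - t) / ((x - t) ^ 2 + h ^ 2))
        + f t * (h / ((x - t) ^ 2 + h ^ 2))) := fun t => by
    rw [inv_sub_add_mul_I hh, boundaryValue]
    simp only [RCLike.re_eq_complex_re, Complex.mul_re, Complex.sub_re, Complex.ofReal_re,
      Complex.ofReal_im, Complex.mul_im, Complex.sub_im, Complex.I_re, Complex.I_im]
    ring
  simp_rw [e] at h0
  rw [integral_const_mul, integral_add (integrable_mul_conjPoissonKernel hf.memLp hh x)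
    (integrable_mul_poissonKernel hf.cont hN hh x)] at h0
  have h1 : conjPoisson F h x + poisson f h x = 0 := by
    simpa [Real.pi_ne_zero, conjPoisson, poisson] using h0
  linarith

lemma bdd_left (hf : IsConjugate f F) : ∃ M, ∀ x, |f x| ≤ M :=
  hf.supp.exists_bound_of_continuous hf.cont

/-- Cotlar's identity for the conjugate Poisson integrals. -/
lemma conjPoisson_mul_eq (hf : IsConjugate f F) (hg : IsConjugate g G) {h : ℝ} (hh : 0 < h)
    (x : ℝ) :
    conjPoisson (fun y => f y * g y) h x = conjPoisson (fun y => F y * G y) h x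
      + poisson (fun y => f y * G y + g y * F y) h x := by
  have h0 := congrArg Complex.re (hf.integral_boundaryValue_mul_mul hg hh x)
  obtain ⟨M, hM⟩ := hf.bdd_left
  obtain ⟨M', hM'⟩ := hf.bdd_conj
  obtain ⟨N, hN⟩ := hg.bdd_left
  obtain ⟨N', hN'⟩ := hg.bdd_conj
  have hK : Continuous fun t : ℝ => ((t : ℂ) - x + h * Complex.I)⁻¹ :=
    (upperDecay_inv hh x).continuous
  have i1 := integrable_mul_conjPoissonKernel_of_integrable
    (hf.memLp.integrable_mul hg.memLp) hh x
  have i2 := integrable_mul_conjPoissonKernel_of_integrable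
    (hf.memLp_left.integrable_mul hg.memLp_left) hh x
  have i3 : Integrable fun t => (f t * G t + g t * F t) * (h / ((x - t) ^ 2 + h ^ 2)) := by
    refine integrable_mul_poissonKernel (by
      have := hf.cont; have := hg.cont; have := hf.cont_conj; have := hg.cont_conj; fun_prop)
      (M := M * N' + N * M') (fun y => ?_) hh x
    refine (abs_add_le _ _).trans (add_le_add ?_ ?_) <;> rw [abs_mul]
    · exact mul_le_mul (hM y) (hN' y) (abs_nonneg _) ((abs_nonneg _).trans (hM y))
    · exact mul_le_mul (hN y) (hM' y) (abs_nonneg _) ((abs_nonneg _).trans (hN y))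
  obtain ⟨C, hC⟩ := (upperDecay_inv hh x).bound
  have hC0 : 0 ≤ C := by simpa using (norm_nonneg _).trans (hC 0 (by simp))
  have hi : Integrable fun t => boundaryValue f F t * boundaryValue g G t
      * ((t : ℂ) - x + h * Complex.I)⁻¹ :=
    (hf.memLp_boundaryValue.integrable_mul hg.memLp_boundaryValue).mul_bdd
      (c := C) hK.aestronglyMeasurable (ae_of_all _ fun t =>
      (hC t (by simp)).trans (div_le_self hC0 (by linarith [norm_nonneg (t : ℂ)])))
  rw [← RCLike.re_eq_complex_re, ← integral_re hi] at h0
  have e : ∀ t, RCLike.re (boundaryValue f F t * boundaryValue g G t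
      * (t - x + h * Complex.I)⁻¹)
      = -Real.pi ^ 2 * ((F * G) t * ((x - t) / ((x - t) ^ 2 + h ^ 2))
        - (f * g) t * ((x - t) / ((x - t) ^ 2 + h ^ 2))
        + (f t * G t + g t * F t) * (h / ((x - t) ^ 2 + h ^ 2))) := fun t => by
    rw [inv_sub_add_mul_I hh, boundaryValue, boundaryValue]
    simp only [RCLike.re_eq_complex_re, Complex.mul_re, Complex.sub_re, Complex.ofReal_re,
      Complex.ofReal_im, Complex.mul_im, Complex.sub_im, Complex.I_re, Complex.I_im,
      Pi.mul_apply]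
    ring
  simp_rw [Pi.mul_apply] at e
  simp only [Pi.mul_apply] at i1 i2
  simp_rw [e] at h0
  have i12 : Integrable fun t => F t * G t * ((x - t) / ((x - t) ^ 2 + h ^ 2))
      - f t * g t * ((x - t) / ((x - t) ^ 2 + h ^ 2)) := i1.sub i2
  rw [integral_const_mul, integral_add i12 i3, integral_sub i1 i2] at h0
  have h1 : conjPoisson (fun y => F y * G y) h x - conjPoisson (fun y => f y * g y) h x
      + poisson (fun y => f y * G y + g y * F y) h x = 0 := by
    simpa [Real.pi_ne_zero, conjPoisson, poisson] using h0
  linarith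

end IsConjugate

/-! ### Principal values -/

lemma integral_eq_zero_of_odd_sub {K : ℝ → ℝ} (hK : ∀ s, K (-s) = -K s) (x : ℝ) :
    ∫ y, K (x - y) = 0 := by
  rw [integral_sub_left_eq_self K volume x]
  have h := integral_neg_eq_self K volume
  simp_rw [hK, integral_neg] at h
  linarith

lemma measurableSet_annulus (x ε R : ℝ) : MeasurableSet {y : ℝ | ε < |x - y| ∧ |x - y| < R} :=
  (measurableSet_lt (measurable_const (a := ε)) (by fun_prop : Measurable fun y => |x - y|)).inter
    (measurableSet_lt (by fun_prop : Measurable fun y => |x - y|) (measurable_const (a := R)))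

lemma measurableSet_lt_abs_sub (x ε : ℝ) : MeasurableSet {y : ℝ | ε < |x - y|} :=
  measurableSet_lt measurable_const (by fun_prop)

lemma setIntegral_annulus_odd {K : ℝ → ℝ} (hK : ∀ s, K (-s) = -K s) (x ε R : ℝ) :
    ∫ y in {y : ℝ | ε < |x - y| ∧ |x - y| < R}, K (x - y) = 0 := by
  rw [← integral_indicator (measurableSet_annulus x ε R)]
  refine Eq.trans ?_ (integral_eq_zero_of_odd_sub
    (K := fun s => if ε < |s| ∧ |s| < R then K s else 0) (fun s => ?_) x)
  · simp only [indicator, mem_ofPred_eq]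
  · simp only [abs_neg, hK]
    split_ifs <;> simp

lemma volume_annulus_lt_top (x ε R : ℝ) :
    volume {y : ℝ | ε < |x - y| ∧ |x - y| < R} < ⊤ := by
  refine (measure_mono (t := Metric.ball x R) fun y hy => ?_).trans_lt measure_ball_lt_top
  rw [Metric.mem_ball, dist_comm, Real.dist_eq]
  exact hy.2

/-- The integral over the annuli in `HasPV` of an integrable function converges to its integral. -/
lemma tendsto_setIntegral_annulus {k : ℝ → ℝ} (hk : Integrable k) (x : ℝ) :
    Tendsto (fun p : ℝ × ℝ => ∫ y in {y | p.1 < |x - y| ∧ |x - y| < p.2}, k y)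
      (𝓝[>] 0 ×ˢ atTop) (𝓝 (∫ y, k y)) := by
  simp_rw [← integral_indicator (measurableSet_annulus x _ _)]
  refine tendsto_integral_filter_of_dominated_convergence (fun y => ‖k y‖)
    (Eventually.of_forall fun p => (hk.indicator (measurableSet_annulus x _ _)).1)
    (Eventually.of_forall fun p => ae_of_all _ fun y => norm_indicator_le_norm_self _ _)
    hk.norm ?_
  have h0 : ∀ᵐ y : ℝ, y ≠ x := by simp [ae_iff]
  filter_upwards [h0] with y hy
  refine tendsto_const_nhds.congr' ?_
  have h1 : ∀ᶠ p : ℝ × ℝ in 𝓝[>] 0 ×ˢ atTop, p.1 < |x - y| :=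
    tendsto_fst.eventually (nhdsWithin_le_nhds (Iio_mem_nhds (abs_pos.2 (sub_ne_zero.2 hy.symm))))
  have h2 : ∀ᶠ p : ℝ × ℝ in 𝓝[>] 0 ×ˢ atTop, |x - y| < p.2 :=
    tendsto_snd.eventually (eventually_gt_atTop _)
  filter_upwards [h1, h2] with p hp1 hp2
  exact (indicator_of_mem (s := {y | p.1 < |x - y| ∧ |x - y| < p.2}) ⟨hp1, hp2⟩ k).symm

lemma integrable_truncatedKernel_sub {w : ℝ → ℝ} (hw : Integrable w) {h : ℝ} (hh : 0 < h) (x : ℝ) :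
    Integrable fun y => w y * (if h < |x - y| then (x - y)⁻¹ else 0) := by
  refine hw.mul_bdd (c := h⁻¹) ?_ (Eventually.of_forall fun y => ?_)
  · exact (Measurable.ite (measurableSet_lt_abs_sub x h) (by fun_prop)
      measurable_const).aestronglyMeasurable
  · split_ifs with hs
    · rw [norm_inv]
      exact inv_anti₀ hh hs.le
    · simp [hh.le]

/-- The difference of the two kernels is odd, so w(x) may be subtracted from w(y), and it is
dominated by the Poisson kernel. What remains is the Poisson integral of |w - w(x)| at x, which
tends to 0 by continuity. -/
lemma tendsto_truncated_sub_conjPoisson {w : ℝ → ℝ} (hw : Continuous w) {M : ℝ}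
    (hM : ∀ x, |w x| ≤ M) (hi : Integrable w) (x : ℝ) :
    Tendsto (fun h => (∫ y in {y | h < |x - y|}, w y / (x - y)) - conjPoisson w h x)
      (𝓝[>] 0) (𝓝 0) := by
  have h1 : Tendsto (fun h => poisson (fun y => |w y - w x|) h x) (𝓝[>] 0) (𝓝 0) := by
    have := tendsto_poisson (w := fun y => |w y - w x|) (by fun_prop) (M := M + M) (fun y => by
      rw [abs_abs]
      exact (abs_sub _ _).trans (add_le_add (hM y) (hM x))) x
    simpa using this
  refine squeeze_zero_norm' ?_ h1
  filter_upwards [self_mem_nhdsWithin] with h hh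
  replace hh : 0 < h := hh
  set d : ℝ → ℝ := fun s => (if h < |s| then s⁻¹ else 0) - s / (s ^ 2 + h ^ 2) with hd
  have hdle : ∀ s, |d s| ≤ h / (s ^ 2 + h ^ 2) := fun s => by
    rw [hd, abs_sub_comm]
    exact abs_conjPoissonKernel_sub_le hh s
  have hdm : Measurable d := by
    refine Measurable.sub (Measurable.ite (measurableSet_lt measurable_const (by fun_prop))
      (by fun_prop) measurable_const) (by fun_prop)
  have hdi : Integrable fun y => d (x - y) :=
    Integrable.mono' (integrable_poissonKernel_sub hh x)
      (hdm.comp (by fun_prop)).aestronglyMeasurable (ae_of_all _ fun y => hdle _)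
  have hd0 : ∫ y, d (x - y) = 0 := integral_eq_zero_of_odd_sub (fun s => by
    simp only [hd, abs_neg, conjPoissonKernel_neg]
    split_ifs
    · rw [inv_neg]; ring
    · ring) x
  have e : (∫ y in {y | h < |x - y|}, w y / (x - y)) - conjPoisson w h x
      = ∫ y, (w y - w x) * d (x - y) := by
    have e1 : ∫ y in {y | h < |x - y|}, w y / (x - y)
        = ∫ y, w y * (if h < |x - y| then (x - y)⁻¹ else 0) := by
      rw [← integral_indicator (measurableSet_lt_abs_sub x h)]
      congr 1
      ext y
      simp only [indicator, mem_ofPred_eq, div_eq_mul_inv]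
      split_ifs <;> simp
    rw [e1, conjPoisson, ← integral_sub (integrable_truncatedKernel_sub hi hh x)
      (integrable_mul_conjPoissonKernel_of_integrable hi hh x)]
    have e2 : ∀ y, (w y - w x) * d (x - y) = w y * d (x - y) - w x * d (x - y) := fun y => by ring
    simp_rw [e2]
    rw [integral_sub _ (hdi.const_mul _), integral_const_mul, hd0, mul_zero, sub_zero]
    · congr 1
      ext y
      simp only [hd]
      ring
    · exact hdi.bdd_mul hw.aestronglyMeasurable (Eventually.of_forall hM)
  rw [e, poisson]
  refine norm_integral_le_of_norm_le (integrable_mul_poissonKernel (by fun_prop) (M := M + M)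
    (fun y => ?_) hh x) (ae_of_all _ fun y => ?_)
  · rw [abs_abs]
    exact (abs_sub _ _).trans (add_le_add (hM y) (hM x))
  · rw [norm_mul]
    exact mul_le_mul_of_nonneg_left (hdle _) (norm_nonneg _)

lemma integrableOn_annulus_div {w : ℝ → ℝ} (hi : Integrable w) (x ε R : ℝ) (hε : 0 < ε) :
    IntegrableOn (fun y => w y / (x - y)) {y | ε < |x - y| ∧ |x - y| < R} := by
  have h1 : IntegrableOn (fun y => w y / (x - y)) {y | ε < |x - y|} := by
    rw [← integrable_indicator_iff (measurableSet_lt_abs_sub x ε)]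
    refine (integrable_truncatedKernel_sub hi hε x).congr (ae_of_all _ fun y => ?_)
    simp only [indicator, mem_ofPred_eq, div_eq_mul_inv]
    split_ifs <;> simp
  exact h1.mono_set fun y hy => hy.1

/-- Once R exceeds |x| plus the radius of a ball about 0 containing the support, the outer
truncation has no effect. -/
lemma tendsto_annulus_iff {w : ℝ → ℝ} (hs : HasCompactSupport w) (x T : ℝ) :
    Tendsto (fun p : ℝ × ℝ => ∫ y in {y | p.1 < |x - y| ∧ |x - y| < p.2}, w y / (x - y))
      (𝓝[>] 0 ×ˢ atTop) (𝓝 T) ↔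
    Tendsto (fun h => ∫ y in {y | h < |x - y|}, w y / (x - y)) (𝓝[>] 0) (𝓝 T) := by
  obtain ⟨M, hM⟩ := hs.isCompact.isBounded.exists_norm_le
  have h1 : (fun p : ℝ × ℝ => ∫ y in {y | p.1 < |x - y| ∧ |x - y| < p.2}, w y / (x - y))
      =ᶠ[𝓝[>] 0 ×ˢ atTop]
      (fun h => ∫ y in {y | h < |x - y|}, w y / (x - y)) ∘ Prod.fst := by
    have h2 : ∀ᶠ p : ℝ × ℝ in 𝓝[>] 0 ×ˢ atTop, |x| + M < p.2 :=
      tendsto_snd.eventually (eventually_gt_atTop _)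
    filter_upwards [h2] with p hp
    simp only [Function.comp]
    rw [← integral_indicator (measurableSet_annulus x _ _),
      ← integral_indicator (measurableSet_lt_abs_sub x _)]
    congr 1
    ext y
    by_cases hy : y ∈ tsupport w
    · have : |x - y| < p.2 := (abs_sub x y).trans_lt (by linarith [hM y hy, Real.norm_eq_abs y])
      simp [indicator, this]
    · simp [indicator, image_eq_zero_of_notMem_tsupport hy]
  rw [tendsto_congr' h1]
  conv_rhs => rw [← map_fst_prod (𝓝[>] (0 : ℝ)) (atTop : Filter ℝ), tendsto_map'_iff]

/-- For continuous compactly supported functions, the principal value exists exactly when the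
conjugate Poisson integral converges. -/
lemma hasPV_div_iff {w : ℝ → ℝ} (hw : Continuous w) (hs : HasCompactSupport w) (x T : ℝ) :
    HasPV (fun y => w y / (x - y)) x T ↔
      Tendsto (fun h => conjPoisson w h x) (𝓝[>] 0) (𝓝 T) := by
  obtain ⟨M, hM⟩ := hs.exists_bound_of_continuous hw
  have hi : Integrable w := hw.integrable_of_hasCompactSupport hs
  have h0 := tendsto_truncated_sub_conjPoisson hw hM hi x
  rw [HasPV, tendsto_annulus_iff hs x T,
    and_iff_right (fun ε R hε => integrableOn_annulus_div hi x ε R hε)]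
  constructor <;> intro h
  · simpa using h.sub h0
  · simpa using h.add h0

lemma hasHilbertAt_iff {w : ℝ → ℝ} (hw : Continuous w) (hs : HasCompactSupport w) (x v : ℝ) :
    HasHilbertAt w x v ↔
      Tendsto (fun h => conjPoisson w h x) (𝓝[>] 0) (𝓝 (Real.pi * v)) := by
  constructor
  · rintro ⟨I, hI, rfl⟩
    have := (hasPV_div_iff hw hs x I).1 hI
    rwa [← mul_assoc, mul_one_div_cancel Real.pi_ne_zero, one_mul]
  · intro h
    refine ⟨Real.pi * v, (hasPV_div_iff hw hs x _).2 h, ?_⟩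
    rw [← mul_assoc, one_div_mul_cancel Real.pi_ne_zero, one_mul]

/-- The product of increments of `F` and `G` integrated against the difference between `1 / s`
and the conjugate Poisson kernel. -/
noncomputable def nearPart (F G : ℝ → ℝ) (h x : ℝ) : ℝ :=
  ∫ y, (F x - F y) * (G x - G y) * ((x - y)⁻¹ - (x - y) / ((x - y) ^ 2 + h ^ 2))

/-- The product of increments of `F` and `G` integrated against the conjugate Poisson kernel. -/
noncomputable def farPart (F G : ℝ → ℝ) (h x : ℝ) : ℝ :=
  conjPoisson (fun y => F y * G y) h x - F x * conjPoisson G h x - G x * conjPoisson F h x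

/-- After 1/s is split into a near kernel and the conjugate Poisson kernel, the product of
increments is expanded only against the latter. The term F(x)G(x) is not integrable against it on
the line, but integrates to zero over every symmetric annulus; everything else is absolutely
integrable. -/
lemma hasPV_increments {F G : ℝ → ℝ} (hF : MemLp F 2) (hG : MemLp G 2) {h : ℝ} (hh : 0 < h) (x : ℝ)
    (hn : Integrable fun y => (F x - F y) * (G x - G y)
      * ((x - y)⁻¹ - (x - y) / ((x - y) ^ 2 + h ^ 2))) :
    HasPV (fun y => (F x - F y) * (G x - G y) / (x - y)) x
      (nearPart F G h x + farPart F G h x) := by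
  set q : ℝ → ℝ := fun s => s / (s ^ 2 + h ^ 2) with hq
  have iFG : Integrable fun y => F y * G y * q (x - y) :=
    integrable_mul_conjPoissonKernel_of_integrable (hF.integrable_mul hG) hh x
  have iF : Integrable fun y => G x * (F y * q (x - y)) :=
    (integrable_mul_conjPoissonKernel hF hh x).const_mul _
  have iG : Integrable fun y => F x * (G y * q (x - y)) :=
    (integrable_mul_conjPoissonKernel hG hh x).const_mul _
  set k : ℝ → ℝ := fun y => (F x - F y) * (G x - G y) * ((x - y)⁻¹ - q (x - y))
    + (F y * G y * q (x - y) - F x * (G y * q (x - y)) - G x * (F y * q (x - y))) with hk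
  have ik : Integrable k := hn.add ((iFG.sub iG).sub iF)
  have ek : ∫ y, k y = nearPart F G h x + farPart F G h x := by
    have i2 : Integrable fun y => F y * G y * q (x - y) - F x * (G y * q (x - y))
      - G x * (F y * q (x - y)) := (iFG.sub iG).sub iF
    have i3 : Integrable fun y => F y * G y * q (x - y) - F x * (G y * q (x - y)) := iFG.sub iG
    rw [hk, integral_add hn i2, integral_sub i3 iF, integral_sub iFG iG, integral_const_mul,
      integral_const_mul]
    rfl
  have iq : ∀ ε R : ℝ, IntegrableOn (fun y => F x * G x * q (x - y))
      {y | ε < |x - y| ∧ |x - y| < R} := fun ε R => by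
    refine IntegrableOn.of_bound (volume_annulus_lt_top x ε R) ?_ (|F x * G x| * h⁻¹)
      (Eventually.of_forall fun y => ?_)
    · exact (((continuous_conjPoissonKernel hh).comp
        (continuous_const.sub continuous_id)).const_mul _).aestronglyMeasurable
    · rw [norm_mul]
      exact mul_le_mul_of_nonneg_left (abs_conjPoissonKernel_le hh _) (norm_nonneg _)
  have e : (fun y => (F x - F y) * (G x - G y) / (x - y))
      = fun y => k y + F x * G x * q (x - y) := by
    ext y
    simp only [hk, div_eq_mul_inv]
    ring
  rw [← ek]
  refine ⟨fun ε R hε => ?_, ?_⟩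
  · rw [e]
    exact ik.integrableOn.add (iq ε R)
  · refine (tendsto_setIntegral_annulus ik x).congr fun p => ?_
    rw [e, integral_add ik.integrableOn (iq _ _), integral_const_mul,
      setIntegral_annulus_odd (conjPoissonKernel_neg h) x, mul_zero, add_zero]

/-! ### The Dini kernel -/

/-- The even function equal to `φ(|s|) ^ θ / |s|` for `0 < |s| ≤ 1`, and to `0` elsewhere. -/
noncomputable def diniKernel (φ : ℝ → ℝ) (θ s : ℝ) : ℝ :=
  (Ioc 0 1).indicator (fun t => φ t ^ θ / t) s + (Ioc 0 1).indicator (fun t => φ t ^ θ / t) (-s)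

namespace IsModulus

variable {φ : ℝ → ℝ} {θ : ℝ} (hφ : IsModulus φ)

include hφ

lemma nonneg {s : ℝ} (hs : 0 ≤ s) : 0 ≤ φ s := by
  rcases hs.eq_or_lt with rfl | h
  · exact hφ.zero.ge
  · exact (hφ.pos s h).le

lemma le {s t : ℝ} (hs : 0 ≤ s) (hst : s ≤ t) : φ s ≤ φ t := hφ.mono hs (hs.trans hst) hst

lemma indicator_nonneg (s : ℝ) : 0 ≤ (Ioc 0 1).indicator (fun t => φ t ^ θ / t) s :=
  Set.indicator_nonneg (fun _ ht => div_nonneg (Real.rpow_nonneg (hφ.nonneg ht.1.le) _) ht.1.le) s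

lemma diniKernel_nonneg (s : ℝ) : 0 ≤ diniKernel φ θ s :=
  add_nonneg (hφ.indicator_nonneg s) (hφ.indicator_nonneg (-s))

lemma div_le_diniKernel {s : ℝ} (hs : s ≠ 0) (hs1 : |s| ≤ 1) :
    φ |s| ^ θ / |s| ≤ diniKernel φ θ s := by
  rcases hs.lt_or_gt with h | h
  · rw [abs_of_neg h] at hs1 ⊢
    have := indicator_of_mem (s := Ioc 0 1) ⟨neg_pos.2 h, hs1⟩ (fun t => φ t ^ θ / t)
    rw [diniKernel, this]
    linarith [hφ.indicator_nonneg (θ := θ) s]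
  · rw [abs_of_pos h] at hs1 ⊢
    have := indicator_of_mem (s := Ioc 0 1) ⟨h, hs1⟩ (fun t => φ t ^ θ / t)
    rw [diniKernel, this]
    linarith [hφ.indicator_nonneg (θ := θ) (-s)]

/-- The Dini condition supplies some r ≤ 1 with a finite integral on (0, r]; on (r, 1] monotonicity
bounds the integrand by φ(1)^θ / r. -/
lemma integrable_diniKernel (hθ : 0 < θ) (hD : DiniPow φ θ) : Integrable (diniKernel φ θ) := by
  have hmeas : ∀ r : ℝ, 0 ≤ r →
      AEStronglyMeasurable (fun s => φ s ^ θ / s) (volume.restrict (Ioc r 1)) := fun r hr => by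
    have h1 : AEMeasurable φ (volume.restrict (Ioc r 1)) :=
      aemeasurable_restrict_of_monotoneOn measurableSet_Ioc
        (hφ.mono.mono fun s hs => hr.trans hs.1.le)
    exact ((h1.pow_const θ).div aemeasurable_id).aestronglyMeasurable
  obtain ⟨r, hr1, hr0, hr⟩ : ∃ r : ℝ, ∫⁻ s in Ioc 0 r, ENNReal.ofReal (φ s ^ θ / s) < 1 ∧
      0 < r ∧ r ≤ 1 := by
    have h1 := hD.eventually (gt_mem_nhds zero_lt_one)
    have h2 : ∀ᶠ r : ℝ in 𝓝[>] 0, r ≤ 1 := nhdsWithin_le_nhds (Iic_mem_nhds one_pos)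
    obtain ⟨r, h⟩ := (h1.and (eventually_mem_nhdsWithin.and h2)).exists
    exact ⟨r, h⟩
  have i1 : IntegrableOn (fun s => φ s ^ θ / s) (Ioc 0 r) := by
    refine ⟨(hmeas 0 le_rfl).mono_measure (Measure.restrict_mono
      (Ioc_subset_Ioc_right hr) le_rfl), ?_⟩
    rw [hasFiniteIntegral_iff_ofReal]
    · exact hr1.trans ENNReal.one_lt_top
    · exact (ae_restrict_mem measurableSet_Ioc).mono fun s hs =>
        div_nonneg (Real.rpow_nonneg (hφ.nonneg hs.1.le) _) hs.1.le
  have i2 : IntegrableOn (fun s => φ s ^ θ / s) (Ioc r 1) := by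
    refine IntegrableOn.of_bound measure_Ioc_lt_top (hmeas r hr0.le) (φ 1 ^ θ / r)
      ((ae_restrict_mem measurableSet_Ioc).mono fun s hs => ?_)
    have hs0 : 0 < s := hr0.trans hs.1
    have hφs := hφ.nonneg hs0.le
    rw [Real.norm_of_nonneg (div_nonneg (Real.rpow_nonneg hφs _) hs0.le)]
    exact div_le_div₀ (Real.rpow_nonneg (hφ.nonneg zero_le_one) _)
      (Real.rpow_le_rpow hφs (hφ.le hs0.le hs.2) hθ.le) hr0 hs.1.le
  have i3 : IntegrableOn (fun s => φ s ^ θ / s) (Ioc 0 1) := by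
    rw [← Ioc_union_Ioc_eq_Ioc hr0.le hr]
    exact i1.union i2
  have i4 := i3.integrable_indicator measurableSet_Ioc
  exact i4.add i4.comp_neg

end IsModulus

/-! ### Functions with a modulus of continuity -/

/-- Quantitative version of `MemCPhi`: `S` bounds the `φ`-seminorm and `N` the sup norm. -/
structure CPhiBound (φ F : ℝ → ℝ) (S N : ℝ) : Prop where
  abs_le : ∀ x, |F x| ≤ N
  abs_sub_le : ∀ x y, |F x - F y| ≤ S * φ |x - y|
  nonneg : 0 ≤ S

namespace CPhiBound

variable {φ F G : ℝ → ℝ} {S N S' N' : ℝ}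

lemma nonneg' (hF : CPhiBound φ F S N) : 0 ≤ N := (abs_nonneg _).trans (hF.abs_le 0)

lemma abs_sub_le_two (hF : CPhiBound φ F S N) (x y : ℝ) : |F x - F y| ≤ 2 * N := by
  linarith [abs_sub (F x) (F y), hF.abs_le x, hF.abs_le y]

lemma continuous (hφ : IsModulus φ) (hF : CPhiBound φ F S N) : Continuous F := by
  refine continuous_iff_continuousAt.2 fun x => ?_
  have h0 : Tendsto φ (𝓝[≥] 0) (𝓝 0) := by
    rw [← Ioi_insert, nhdsWithin_insert]
    refine Tendsto.sup ?_ hφ.tendsto_zero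
    have := tendsto_pure_nhds φ 0
    rwa [hφ.zero] at this
  have h1 : Tendsto (fun y => |x - y|) (𝓝 x) (𝓝[≥] 0) := by
    refine tendsto_nhdsWithin_iff.2 ⟨?_, Eventually.of_forall fun y => mem_Ici.2 (abs_nonneg _)⟩
    have : Continuous fun y => |x - y| := by fun_prop
    simpa using this.tendsto x
  have h2 := (h0.comp h1).const_mul S
  rw [mul_zero] at h2
  rw [ContinuousAt, tendsto_iff_norm_sub_tendsto_zero]
  refine squeeze_zero (fun y => norm_nonneg _) (fun y => ?_) h2
  rw [Real.norm_eq_abs, abs_sub_comm]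
  exact hF.abs_sub_le x y

lemma abs_sub_le_of_le (hφ : IsModulus φ) (hF : CPhiBound φ F S N) {x y h : ℝ}
    (hxy : |x - y| ≤ h) : |F x - F y| ≤ S * φ h :=
  (hF.abs_sub_le x y).trans
    (mul_le_mul_of_nonneg_left (hφ.le (abs_nonneg _) hxy) hF.nonneg)

lemma abs_sub_chain (hF : CPhiBound φ F S N) (x d : ℝ) (n : ℕ) :
    |F (x + n * d) - F x| ≤ n * (S * φ |d|) := by
  induction n with
  | zero => simp
  | succ n ih =>
    have h1 := hF.abs_sub_le (x + (n + 1 : ℕ) * d) (x + n * d)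
    have h2 : x + (n + 1 : ℕ) * d - (x + n * d) = d := by push_cast; ring
    rw [h2] at h1
    have h3 := _root_.abs_sub_le (F (x + (n + 1 : ℕ) * d)) (F (x + n * d)) (F x)
    push_cast at h1 h3 ⊢
    linarith

/-- Increments at scale larger than `h` are controlled linearly by those at scale `h`. -/
lemma abs_sub_le_of_ge (hφ : IsModulus φ) (hF : CPhiBound φ F S N) {x y h : ℝ} (hh : 0 < h)
    (hxy : h ≤ |x - y|) : |F x - F y| ≤ S * φ h * (2 * |x - y| / h) := by
  -- The segment is cut into n steps of length at most h; rounding up costs at most a factor 2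
  -- because |x - y| / h ≥ 1.
  set n := ⌈|x - y| / h⌉₊ with hn
  have h1 : |x - y| / h ≤ n := Nat.le_ceil _
  have h2 : (n : ℝ) < |x - y| / h + 1 := Nat.ceil_lt_add_one (by positivity)
  have h3 : 1 ≤ |x - y| / h := (one_le_div hh).2 hxy
  have hn0 : (0 : ℝ) < n := by linarith
  have h4 := hF.abs_sub_chain y ((x - y) / n) n
  have h5 : y + n * ((x - y) / n) = x := by field_simp; ring
  rw [h5] at h4
  have h6 : |(x - y) / n| ≤ h := by
    rw [abs_div, abs_of_pos hn0, div_le_iff₀ hn0]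
    rwa [div_le_iff₀ hh, mul_comm] at h1
  have h7 := mul_le_mul_of_nonneg_left (hφ.le (abs_nonneg _) h6) hF.nonneg
  refine h4.trans ((mul_le_mul_of_nonneg_left h7 hn0.le).trans ?_)
  rw [mul_comm]
  refine mul_le_mul_of_nonneg_left ?_ (mul_nonneg hF.nonneg (hφ.nonneg hh.le))
  rw [mul_div_assoc]
  linarith

end CPhiBound

/-! ### Estimates for the near part. -/

lemma abs_inv_sub_conjPoissonKernel {h : ℝ} (hh : 0 < h) (s : ℝ) (hs : s ≠ 0) :
    |s⁻¹ - s / (s ^ 2 + h ^ 2)| = |s|⁻¹ * (h * (h / (s ^ 2 + h ^ 2))) := by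
  have hp := sq_add_sq_pos s hh
  have : s⁻¹ - s / (s ^ 2 + h ^ 2) = s⁻¹ * (h * (h / (s ^ 2 + h ^ 2))) := by
    field_simp
    ring
  rw [this, abs_mul, abs_inv, abs_of_nonneg (by positivity : 0 ≤ h * (h / (s ^ 2 + h ^ 2)))]

lemma mul_poissonKernel_le_one {h : ℝ} (hh : 0 < h) (s : ℝ) : h * (h / (s ^ 2 + h ^ 2)) ≤ 1 := by
  rw [← mul_div_assoc, div_le_one (sq_add_sq_pos s hh)]
  nlinarith [sq_nonneg s]

section

variable {φ F G : ℝ → ℝ} {θ S N S' N' E : ℝ} (hφ : IsModulus φ) (hF : CPhiBound φ F S N)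
  (hG : CPhiBound φ G S' N') (hE : ∀ x y, |G x - G y| ≤ E * φ |x - y| ^ θ) (hE0 : 0 ≤ E)

include hφ hF hG hE hE0

/-- The near kernel is |s|⁻¹ · h²/(s² + h²) in absolute value. For |s| ≤ h the increment of F gives
φ(h) and that of G, with |s|⁻¹, the Dini kernel. For |s| > h the linear growth of the increment of F
cancels |s|⁻¹ and leaves φ(h) times the Poisson kernel, while G is bounded trivially. -/
lemma abs_nearPart_integrand_le {h : ℝ} (hh : 0 < h) (hh1 : h ≤ 1) (x y : ℝ) :
    |(F x - F y) * (G x - G y) * ((x - y)⁻¹ - (x - y) / ((x - y) ^ 2 + h ^ 2))|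
      ≤ S * E * φ h * diniKernel φ θ (x - y)
        + 4 * S * N' * φ h * (h / ((x - y) ^ 2 + h ^ 2)) := by
  have hS := hF.nonneg
  have hN := hG.nonneg'
  have hφh := hφ.nonneg hh.le
  have hp := poissonKernel_nonneg (x - y) hh
  have hd := hφ.diniKernel_nonneg (θ := θ) (x - y)
  have t1 : 0 ≤ S * E * φ h * diniKernel φ θ (x - y) := by positivity
  have t2 : 0 ≤ 4 * S * N' * φ h * (h / ((x - y) ^ 2 + h ^ 2)) := by positivity
  rcases eq_or_ne (x - y) 0 with h0 | h0
  · rw [sub_eq_zero.1 h0] at t1 t2 ⊢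
    simpa using add_nonneg t1 t2
  have hs : 0 < |x - y| := abs_pos.2 h0
  rw [abs_mul, abs_mul, abs_inv_sub_conjPoissonKernel hh _ h0]
  rcases le_or_gt |x - y| h with hle | hgt
  · have b1 := hF.abs_sub_le_of_le hφ hle
    have b2 : |G x - G y| * |x - y|⁻¹ ≤ E * diniKernel φ θ (x - y) := by
      refine (mul_le_mul_of_nonneg_right (hE x y) (inv_nonneg.2 hs.le)).trans ?_
      rw [mul_assoc, ← div_eq_mul_inv]
      exact mul_le_mul_of_nonneg_left (hφ.div_le_diniKernel h0 (hle.trans hh1)) hE0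
    have b3 := mul_poissonKernel_le_one hh (x - y)
    calc _ = |F x - F y| * (|G x - G y| * |x - y|⁻¹) * (h * (h / ((x - y) ^ 2 + h ^ 2))) := by ring
      _ ≤ (S * φ h) * (E * diniKernel φ θ (x - y)) * 1 := by gcongr
      _ = S * E * φ h * diniKernel φ θ (x - y) := by ring
      _ ≤ _ := le_add_of_nonneg_right t2
  · have b1 := hF.abs_sub_le_of_ge hφ hh hgt.le
    have b2 := hG.abs_sub_le_two x y
    calc _ ≤ S * φ h * (2 * |x - y| / h) * (2 * N')
          * (|x - y|⁻¹ * (h * (h / ((x - y) ^ 2 + h ^ 2)))) := by gcongr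
      _ = 4 * S * N' * φ h * (h / ((x - y) ^ 2 + h ^ 2)) * (|x - y| * |x - y|⁻¹) * (h / h) := by ring
      _ = 4 * S * N' * φ h * (h / ((x - y) ^ 2 + h ^ 2)) := by
        rw [mul_inv_cancel₀ hs.ne', div_self hh.ne', mul_one, mul_one]
      _ ≤ _ := le_add_of_nonneg_left t1

variable (hψ : Integrable (diniKernel φ θ))

include hψ

lemma integrable_nearPart {h : ℝ} (hh : 0 < h) (hh1 : h ≤ 1) (x : ℝ) :
    Integrable fun y => (F x - F y) * (G x - G y)
      * ((x - y)⁻¹ - (x - y) / ((x - y) ^ 2 + h ^ 2)) := by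
  have hFc := hF.continuous hφ
  have hGc := hG.continuous hφ
  refine Integrable.mono' (((hψ.comp_sub_left x).const_mul (S * E * φ h)).add
    ((integrable_poissonKernel_sub hh x).const_mul (4 * S * N' * φ h))) ?_
    (ae_of_all _ fun y => abs_nearPart_integrand_le hφ hF hG hE hE0 hh hh1 x y)
  have h1 : Measurable F := hFc.measurable
  have h2 : Measurable G := hGc.measurable
  exact Measurable.aestronglyMeasurable (by fun_prop)

lemma abs_nearPart_le {h : ℝ} (hh : 0 < h) (hh1 : h ≤ 1) (x : ℝ) :
    |nearPart F G h x| ≤ φ h * (S * E * ∫ s, diniKernel φ θ s) + φ h * (4 * Real.pi * S * N') := by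
  have i1 := (hψ.comp_sub_left x).const_mul (S * E * φ h)
  have i2 := (integrable_poissonKernel_sub hh x).const_mul (4 * S * N' * φ h)
  have h1 := norm_integral_le_of_norm_le
    (f := fun y => (F x - F y) * (G x - G y) * ((x - y)⁻¹ - (x - y) / ((x - y) ^ 2 + h ^ 2)))
    (i1.add i2)
    (ae_of_all _ fun y => abs_nearPart_integrand_le hφ hF hG hE hE0 hh hh1 x y)
  simp only [Pi.add_apply] at h1
  rw [integral_add i1 i2, integral_const_mul, integral_const_mul, integral_poissonKernel_sub hh,
    integral_sub_left_eq_self (diniKernel φ θ)] at h1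
  refine h1.trans (le_of_eq ?_)
  ring

end

/-! ### Translates of the conjugate Poisson kernel -/

/-- A translation by exactly the scale h of the kernel gains one power of decay, so the difference
is integrable although each kernel is not. -/
lemma abs_conjPoissonKernel_add_sub_le {h : ℝ} (hh : 0 < h) {d : ℝ} (hd : |d| = h) (s : ℝ) :
    |(s + d) / ((s + d) ^ 2 + h ^ 2) - s / (s ^ 2 + h ^ 2)| ≤ 2 * (h / (s ^ 2 + h ^ 2)) := by
  have hp := sq_add_sq_pos s hh
  have hp' := sq_add_sq_pos (s + d) hh
  have hd2 : d ^ 2 = h ^ 2 := by rw [← sq_abs, hd]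
  have e : (s + d) / ((s + d) ^ 2 + h ^ 2) - s / (s ^ 2 + h ^ 2)
      = d * (h ^ 2 - s * (s + d)) / ((s + d) ^ 2 + h ^ 2) / (s ^ 2 + h ^ 2) := by
    field_simp
    ring
  rw [e, abs_div, abs_div, abs_mul, abs_of_pos hp, abs_of_pos hp', hd, ← mul_div_assoc]
  refine div_le_div_of_nonneg_right ?_ hp.le
  rw [div_le_iff₀ hp']
  have h1 : |h ^ 2 - s * (s + d)| ≤ 2 * ((s + d) ^ 2 + h ^ 2) := by
    rw [abs_le]
    constructor <;> nlinarith [sq_nonneg s, sq_nonneg d, sq_nonneg (s + d), sq_nonneg (2 * s + d),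
      sq_nonneg (2 * s + 3 * d), sq_nonneg (s + 2 * d)]
  nlinarith

lemma integrable_conjPoissonKernel_add_sub {h : ℝ} (hh : 0 < h) {d : ℝ} (hd : |d| = h) :
    Integrable fun s : ℝ => (s + d) / ((s + d) ^ 2 + h ^ 2) - s / (s ^ 2 + h ^ 2) :=
  Integrable.mono' ((integrable_poissonKernel hh).const_mul 2)
    (((continuous_conjPoissonKernel hh).comp (continuous_add_const d)).sub
      (continuous_conjPoissonKernel hh)).aestronglyMeasurable
    (ae_of_all _ fun s => abs_conjPoissonKernel_add_sub_le hh hd s)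

lemma tendsto_div_sq_add_sq {l : Filter ℝ} (hl : Tendsto (fun s : ℝ => |s|) l atTop) (h d : ℝ) :
    Tendsto (fun s : ℝ => ((s + d) ^ 2 + h ^ 2) / (s ^ 2 + h ^ 2)) l (𝓝 1) := by
  have h1 : Tendsto (fun s : ℝ => |s|⁻¹) l (𝓝 0) := tendsto_inv_atTop_zero.comp hl
  have h2 : Tendsto (fun s : ℝ => s⁻¹) l (𝓝 0) := by
    rw [tendsto_zero_iff_abs_tendsto_zero]
    simpa only [Function.comp_def, abs_inv] using h1
  have h3 : Tendsto (fun s : ℝ => ((1 + d * s⁻¹) ^ 2 + (h * s⁻¹) ^ 2) / (1 + (h * s⁻¹) ^ 2)) l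
      (𝓝 (((1 + d * 0) ^ 2 + (h * 0) ^ 2) / (1 + (h * 0) ^ 2))) :=
    ((((h2.const_mul d).const_add 1).pow 2).add ((h2.const_mul h).pow 2)).div
      (((h2.const_mul h).pow 2).const_add 1) (by norm_num)
  simp only [mul_zero, add_zero, one_pow, ne_eq, OfNat.ofNat_ne_zero, not_false_eq_true, zero_pow,
    div_one] at h3
  refine h3.congr' ?_
  filter_upwards [hl.eventually (eventually_gt_atTop 0)] with s hs
  have hs0 : s ≠ 0 := abs_pos.1 hs
  have : 0 < s ^ 2 + h ^ 2 := by positivity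
  have h4 : 0 < 1 + (h * s⁻¹) ^ 2 := by positivity
  rw [div_eq_div_iff h4.ne' this.ne']
  field_simp

/-- An antiderivative is half the logarithm of ((s + d)² + h²)/(s² + h²), which tends to 0 at both
ends. -/
lemma integral_conjPoissonKernel_add_sub {h : ℝ} (hh : 0 < h) {d : ℝ} (hd : |d| = h) :
    ∫ s : ℝ, ((s + d) / ((s + d) ^ 2 + h ^ 2) - s / (s ^ 2 + h ^ 2)) = 0 := by
  have hlim : ∀ l : Filter ℝ, Tendsto (fun s : ℝ => |s|) l atTop →
      Tendsto (fun s : ℝ => 1 / 2 * Real.log ((s + d) ^ 2 + h ^ 2)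
        - 1 / 2 * Real.log (s ^ 2 + h ^ 2)) l (𝓝 0) := fun l hl => by
    have := ((Real.continuousAt_log one_ne_zero).tendsto.comp
      (tendsto_div_sq_add_sq hl h d)).const_mul (1 / 2)
    rw [Real.log_one, mul_zero] at this
    refine this.congr fun s => ?_
    simp only [Function.comp]
    rw [Real.log_div (sq_add_sq_pos _ hh).ne' (sq_add_sq_pos _ hh).ne']
    ring
  have := integral_of_hasDerivAt_of_tendsto (fun s => ?_)
    (integrable_conjPoissonKernel_add_sub hh hd)
    (hlim _ tendsto_abs_atBot_atTop) (hlim _ tendsto_abs_atTop_atTop)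
  · simpa using this
  · have h1 : HasDerivAt (fun s : ℝ => (s + d) ^ 2 + h ^ 2) (2 * (s + d)) s := by
      simpa using (((hasDerivAt_id s).add_const d).pow 2).add_const (h ^ 2)
    have h2 : HasDerivAt (fun s : ℝ => s ^ 2 + h ^ 2) (2 * s) s := by
      simpa using ((hasDerivAt_id s).pow 2).add_const (h ^ 2)
    refine (((h1.log (sq_add_sq_pos _ hh).ne').const_mul (1 / 2)).sub
      ((h2.log (sq_add_sq_pos _ hh).ne').const_mul (1 / 2))).congr_deriv ?_
    ring

/-- The kernel difference has integral zero, so the constant F(x')G(x') can be added under the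
integral to complete the product of increments at x'. The two last terms compensate for using F(x'),
G(x') in place of F(x), G(x). -/
lemma farPart_sub_eq {F G : ℝ → ℝ} (hF : MemLp F 2) (hG : MemLp G 2) {h : ℝ} (hh : 0 < h)
    {x x' : ℝ} (hx : |x - x'| = h) :
    farPart F G h x - farPart F G h x'
      = (∫ y, (F x' - F y) * (G x' - G y)
          * ((x - y) / ((x - y) ^ 2 + h ^ 2) - (x' - y) / ((x' - y) ^ 2 + h ^ 2)))
        - (F x - F x') * conjPoisson G h x - (G x - G x') * conjPoisson F h x := by
  have hΔ : Integrable fun y : ℝ =>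
      (x - y) / ((x - y) ^ 2 + h ^ 2) - (x' - y) / ((x' - y) ^ 2 + h ^ 2) := by
    have := (integrable_conjPoissonKernel_add_sub hh hx).comp_sub_left x'
    refine this.congr (ae_of_all _ fun y => ?_)
    have e : x' - y + (x - x') = x - y := by ring
    simp only [e]
  have hΔ0 : ∫ y : ℝ, ((x - y) / ((x - y) ^ 2 + h ^ 2) - (x' - y) / ((x' - y) ^ 2 + h ^ 2)) = 0 := by
    have := integral_sub_left_eq_self
      (fun s : ℝ => (s + (x - x')) / ((s + (x - x')) ^ 2 + h ^ 2) - s / (s ^ 2 + h ^ 2)) volume x'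
    rw [integral_conjPoissonKernel_add_sub hh hx] at this
    rw [← this]
    congr 1
    ext y
    have e : x' - y + (x - x') = x - y := by ring
    simp only [e]
  have jFG := integrable_mul_conjPoissonKernel_of_integrable (hF.integrable_mul hG) hh
  have jF := integrable_mul_conjPoissonKernel hF hh
  have jG := integrable_mul_conjPoissonKernel hG hh
  simp only [Pi.mul_apply] at jFG
  have e : ∀ y, (F x' - F y) * (G x' - G y)
      * ((x - y) / ((x - y) ^ 2 + h ^ 2) - (x' - y) / ((x' - y) ^ 2 + h ^ 2))
      = (F y * G y * ((x - y) / ((x - y) ^ 2 + h ^ 2))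
          - F y * G y * ((x' - y) / ((x' - y) ^ 2 + h ^ 2)))
        - F x' * (G y * ((x - y) / ((x - y) ^ 2 + h ^ 2))
          - G y * ((x' - y) / ((x' - y) ^ 2 + h ^ 2)))
        - G x' * (F y * ((x - y) / ((x - y) ^ 2 + h ^ 2))
          - F y * ((x' - y) / ((x' - y) ^ 2 + h ^ 2)))
        + F x' * G x' * ((x - y) / ((x - y) ^ 2 + h ^ 2)
          - (x' - y) / ((x' - y) ^ 2 + h ^ 2)) := fun y => by ring
  simp_rw [e]
  have k1 : Integrable fun y => F y * G y * ((x - y) / ((x - y) ^ 2 + h ^ 2))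
          - F y * G y * ((x' - y) / ((x' - y) ^ 2 + h ^ 2)) := (jFG x).sub (jFG x')
  have k2 : Integrable fun y => F x' * (G y * ((x - y) / ((x - y) ^ 2 + h ^ 2))
          - G y * ((x' - y) / ((x' - y) ^ 2 + h ^ 2))) := ((jG x).sub (jG x')).const_mul _
  have k3 : Integrable fun y => G x' * (F y * ((x - y) / ((x - y) ^ 2 + h ^ 2))
          - F y * ((x' - y) / ((x' - y) ^ 2 + h ^ 2))) := ((jF x).sub (jF x')).const_mul _
  have k12 := k1.sub k2
  have k123 := k12.sub k3
  have e2 := integral_add' k123 (hΔ.const_mul (F x' * G x'))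
  rw [integral_sub' k12 k3, integral_sub' k1 k2, integral_const_mul, integral_const_mul,
    integral_const_mul, hΔ0, integral_sub (jFG x) (jFG x'), integral_sub (jG x) (jG x'),
    integral_sub (jF x) (jF x')] at e2
  simp only [Pi.add_apply, Pi.sub_apply] at e2
  rw [e2]
  simp only [farPart, conjPoisson]
  ring

section

variable {φ F G : ℝ → ℝ} {θ S N S' N' E : ℝ} (hφ : IsModulus φ) (hF : CPhiBound φ F S N)
  (hG : CPhiBound φ G S' N') (hE : ∀ x y, |G x - G y| ≤ E * φ |x - y| ^ θ) (hE0 : 0 ≤ E)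

include hφ hF hG hE hE0

/-- Three ranges of s = x' - y, one per summand. For h < |s| ≤ 1 the increment of F is at most
2Sφ(h)|s|/h, the increment of G is E φ(|s|)^θ, and the kernel is at most 2h/s², which together
produce φ(h) times the Dini kernel. For |s| ≤ h and |s| > 1 the increment of G is bounded by 2N'. -/
lemma abs_farPart_sub_integrand_le {c : ℝ} (hc : 0 < c) {h : ℝ} (hh : 0 < h) (hch : c * h ≤ φ h)
    {x x' : ℝ} (hx : |x - x'| = h) (y : ℝ) :
    |(F x' - F y) * (G x' - G y)
          * ((x - y) / ((x - y) ^ 2 + h ^ 2) - (x' - y) / ((x' - y) ^ 2 + h ^ 2))|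
      ≤ 4 * S * E * φ h * diniKernel φ θ (x' - y)
        + 4 * S * N' * φ h * (h / ((x' - y) ^ 2 + h ^ 2))
        + 16 * N * N' / c * φ h * (1 + (x' - y) ^ 2)⁻¹ := by
  have hS := hF.nonneg
  have hN := hF.nonneg'
  have hN' := hG.nonneg'
  have hφh := hφ.nonneg hh.le
  have hp := poissonKernel_nonneg (x' - y) hh
  have hp0 := sq_add_sq_pos (x' - y) hh
  have hd := hφ.diniKernel_nonneg (θ := θ) (x' - y)
  have t1 : 0 ≤ 4 * S * E * φ h * diniKernel φ θ (x' - y) := by positivity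
  have t2 : 0 ≤ 4 * S * N' * φ h * (h / ((x' - y) ^ 2 + h ^ 2)) := by positivity
  have t3 : 0 ≤ 16 * N * N' / c * φ h * (1 + (x' - y) ^ 2)⁻¹ := by positivity
  have hΔ := abs_conjPoissonKernel_add_sub_le hh hx (x' - y)
  have e : x' - y + (x - x') = x - y := by ring
  rw [e] at hΔ
  rw [abs_mul, abs_mul]
  have g2 := hG.abs_sub_le_two x' y
  rcases le_or_gt |x' - y| h with hle | hgt
  · have b1 := hF.abs_sub_le_of_le hφ hle
    calc _ ≤ (S * φ h) * (2 * N') * (2 * (h / ((x' - y) ^ 2 + h ^ 2))) := by gcongr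
      _ = 4 * S * N' * φ h * (h / ((x' - y) ^ 2 + h ^ 2)) := by ring
      _ ≤ _ := by linarith
  have hs : 0 < |x' - y| := hh.trans hgt
  have hs0 : x' - y ≠ 0 := abs_pos.1 hs
  rcases le_or_gt |x' - y| 1 with hle | hgt1
  · have b1 := hF.abs_sub_le_of_ge hφ hh hgt.le
    have b2 : |G x' - G y| ≤ E * (diniKernel φ θ (x' - y) * |x' - y|) := by
      refine (hE x' y).trans (mul_le_mul_of_nonneg_left ?_ hE0)
      rw [← div_le_iff₀ hs]
      exact hφ.div_le_diniKernel hs0 hle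
    have b3 : |x' - y| * |x' - y| / ((x' - y) ^ 2 + h ^ 2) ≤ 1 := by
      rw [div_le_one hp0, abs_mul_abs_self]
      nlinarith [sq_nonneg h]
    calc _ ≤ (S * φ h * (2 * |x' - y| / h)) * (E * (diniKernel φ θ (x' - y) * |x' - y|))
          * (2 * (h / ((x' - y) ^ 2 + h ^ 2))) := by gcongr
      _ = 4 * S * E * φ h * diniKernel φ θ (x' - y)
          * (|x' - y| * |x' - y| / ((x' - y) ^ 2 + h ^ 2)) * (h / h) := by ring
      _ ≤ 4 * S * E * φ h * diniKernel φ θ (x' - y) * 1 * 1 := by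
        rw [div_self hh.ne']
        gcongr
      _ ≤ _ := by linarith
  · have b1 := hF.abs_sub_le_two x' y
    -- On the tail no increment is small; the factor φ(h) comes from the kernel, through h ≤ φ(h)/c.
    have b3 : h / ((x' - y) ^ 2 + h ^ 2) ≤ φ h / c * (2 * (1 + (x' - y) ^ 2)⁻¹) := by
      have h1 : h ≤ φ h / c := by rwa [le_div_iff₀ hc, mul_comm]
      have h2 : ((x' - y) ^ 2 + h ^ 2)⁻¹ ≤ 2 * (1 + (x' - y) ^ 2)⁻¹ := by
        rw [← div_eq_mul_inv, inv_eq_one_div, div_le_div_iff₀ hp0 (by positivity)]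
        have : 1 ≤ (x' - y) ^ 2 := by
          rw [← sq_abs]
          nlinarith
        nlinarith [sq_nonneg h]
      rw [div_eq_mul_inv]
      exact mul_le_mul h1 h2 (inv_nonneg.2 hp0.le) (hh.le.trans h1)
    calc _ ≤ (2 * N) * (2 * N') * (2 * (φ h / c * (2 * (1 + (x' - y) ^ 2)⁻¹))) := by
          gcongr
          exact hΔ.trans (by gcongr)
      _ = 16 * N * N' / c * φ h * (1 + (x' - y) ^ 2)⁻¹ := by ring
      _ ≤ _ := by linarith

variable (hψ : Integrable (diniKernel φ θ))

include hψ

lemma abs_farPart_sub_le {m m' c : ℝ} (hc : 0 < c) {h : ℝ} (hh : 0 < h) (hch : c * h ≤ φ h)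
    (hF2 : MemLp F 2) (hG2 : MemLp G 2) (hQF : ∀ x, |conjPoisson F h x| ≤ m)
    (hQG : ∀ x, |conjPoisson G h x| ≤ m') {x x' : ℝ} (hx : |x - x'| = h) :
    |farPart F G h x - farPart F G h x'|
      ≤ φ h * (4 * S * E * ∫ s, diniKernel φ θ s) + φ h * (4 * Real.pi * S * N')
        + φ h * (16 * Real.pi / c * N * N') + φ h * (S * m') + φ h * (S' * m) := by
  have i1 := (hψ.comp_sub_left x').const_mul (4 * S * E * φ h)
  have i2 := (integrable_poissonKernel_sub hh x').const_mul (4 * S * N' * φ h)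
  have i3 := (integrable_inv_one_add_sq.comp_sub_left x').const_mul (16 * N * N' / c * φ h)
  have h1 := norm_integral_le_of_norm_le
    (f := fun y => (F x' - F y) * (G x' - G y)
          * ((x - y) / ((x - y) ^ 2 + h ^ 2) - (x' - y) / ((x' - y) ^ 2 + h ^ 2)))
    ((i1.add i2).add i3)
    (ae_of_all _ fun y => abs_farPart_sub_integrand_le hφ hF hG hE hE0 hc hh hch hx y)
  simp only [Pi.add_apply] at h1
  have i12 : Integrable fun y => 4 * S * E * φ h * diniKernel φ θ (x' - y)
        + 4 * S * N' * φ h * (h / ((x' - y) ^ 2 + h ^ 2)) := i1.add i2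
  rw [integral_add i12 i3, integral_add i1 i2, integral_const_mul,
    integral_const_mul, integral_const_mul, integral_poissonKernel_sub hh,
    integral_sub_left_eq_self (diniKernel φ θ),
    integral_sub_left_eq_self (fun s : ℝ => (1 + s ^ 2)⁻¹), integral_univ_inv_one_add_sq,
    Real.norm_eq_abs] at h1
  have hS := hF.nonneg
  have hS' := hG.nonneg
  have hφh := hφ.nonneg hh.le
  have h2 : |(F x - F x') * conjPoisson G h x| ≤ S * φ h * m' := by
    rw [abs_mul]
    exact mul_le_mul (hF.abs_sub_le_of_le hφ hx.le) (hQG x) (abs_nonneg _) (by positivity)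
  have h3 : |(G x - G x') * conjPoisson F h x| ≤ S' * φ h * m := by
    rw [abs_mul]
    exact mul_le_mul (hG.abs_sub_le_of_le hφ hx.le) (hQF x) (abs_nonneg _) (by positivity)
  rw [farPart_sub_eq hF2 hG2 hh hx]
  refine (abs_sub _ _).trans ((add_le_add ((abs_sub _ _).trans (add_le_add h1 h2)) h3).trans
    (le_of_eq ?_))
  ring

omit hF in
/-- A bound for the conjugate Poisson integral in terms of the oscillation of `G` on the unit scale,
its sup norm, and its `L²` norm. -/
lemma abs_conjPoisson_le {L m : ℝ} (hL : 0 < L) (hm : 0 ≤ m) (hG2 : MemLp G 2)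
    (hGm : ∫ y, G y ^ 2 ≤ L * m ^ 2) {h : ℝ} (hh : 0 < h) (x : ℝ) :
    |conjPoisson G h x| ≤ E * (∫ s, diniKernel φ θ s) + 2 * (2 * Real.pi * L + 1) * N' + m := by
  have hN' := hG.nonneg'
  set R := 2 * Real.pi * L + 1 with hR
  have hR1 : 1 ≤ R := by rw [hR]; nlinarith [mul_pos Real.pi_pos hL]
  have hR0 : 0 < R := by linarith
  rcases hm.eq_or_lt with rfl | hm
  · have h0 : ∫ y, G y ^ 2 = 0 := le_antisymm (by simpa using hGm) (by positivity)
    rw [integral_eq_zero_iff_of_nonneg (fun y => sq_nonneg _) hG2.integrable_sq] at h0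
    have h1 : conjPoisson G h x = 0 := by
      rw [conjPoisson]
      refine integral_eq_zero_of_ae (h0.mono fun y hy => ?_)
      have : G y = 0 := by simpa using hy
      simp [this]
    have h2 : 0 ≤ ∫ s, diniKernel φ θ s := integral_nonneg hφ.diniKernel_nonneg
    rw [h1, abs_zero]
    positivity
  -- Weight for |G| |s|⁻¹ ≤ (lam/2) G² + (2 lam)⁻¹ s⁻² on |s| > R. With this weight and R = 2πL + 1
  -- each of the two terms integrates to at most m/2. The case m = 0 was separated to have lam > 0.
  set lam := (L * m)⁻¹ with hlam
  have hlam0 : 0 < lam := by positivity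
  -- The odd kernel cut off at distance 1 has integral zero, so G(x) can be subtracted there to
  -- bring in the Dini kernel.
  set K : ℝ → ℝ := fun s => if |s| ≤ 1 then s / (s ^ 2 + h ^ 2) else 0 with hK
  have hK0 : ∫ y, K (x - y) = 0 := integral_eq_zero_of_odd_sub (fun s => by
    simp only [hK, abs_neg, conjPoissonKernel_neg]
    split_ifs <;> simp) x
  have hKi : Integrable fun y => K (x - y) := by
    have : Integrable K := by
      have h1 : IntegrableOn (fun s : ℝ => s / (s ^ 2 + h ^ 2)) (Icc (-1) 1) :=
        (continuous_conjPoissonKernel hh).integrableOn_Icc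
      refine (h1.integrable_indicator measurableSet_Icc).congr (ae_of_all _ fun s => ?_)
      simp only [indicator, mem_Icc, hK, abs_le]
    exact this.comp_sub_left x
  have e : conjPoisson G h x
      = ∫ y, (G y * ((x - y) / ((x - y) ^ 2 + h ^ 2)) - G x * K (x - y)) := by
    rw [integral_sub (integrable_mul_conjPoissonKernel hG2 hh x) (hKi.const_mul _),
      integral_const_mul, hK0, mul_zero, sub_zero, conjPoisson]
  have i1 := (hψ.comp_sub_left x).const_mul E
  have i2 : Integrable ((Metric.closedBall x R).indicator fun _ => N') :=
    (integrableOn_const measure_closedBall_lt_top.ne).integrable_indicator measurableSet_closedBall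
  have i3 := (hG2.integrable_sq).const_mul (lam / 2)
  have i4 := (integrable_poissonKernel_sub hR0 x).const_mul ((lam * R)⁻¹)
  have hb : ∀ y, |G y * ((x - y) / ((x - y) ^ 2 + h ^ 2)) - G x * K (x - y)|
      ≤ E * diniKernel φ θ (x - y) + (Metric.closedBall x R).indicator (fun _ => N') y
        + lam / 2 * G y ^ 2 + (lam * R)⁻¹ * (R / ((x - y) ^ 2 + R ^ 2)) := fun y => by
    have t1 : 0 ≤ E * diniKernel φ θ (x - y) := mul_nonneg hE0 (hφ.diniKernel_nonneg _)
    have t2 : 0 ≤ (Metric.closedBall x R).indicator (fun _ => N') y :=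
      Set.indicator_nonneg (fun _ _ => hN') y
    have t3 : 0 ≤ lam / 2 * G y ^ 2 := by positivity
    have t4 : 0 ≤ (lam * R)⁻¹ * (R / ((x - y) ^ 2 + R ^ 2)) := by positivity
    have hq := abs_conjPoissonKernel_le_inv h (x - y)
    rcases le_or_gt |x - y| 1 with h1 | h1
    · rw [hK]
      simp only [if_pos h1]
      rw [← sub_mul, abs_mul]
      refine le_trans ?_ (by linarith : E * diniKernel φ θ (x - y) ≤ _)
      rcases eq_or_ne (x - y) 0 with h0 | h0
      · rw [h0] at t1 ⊢
        simpa using t1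
      refine (mul_le_mul (hE y x) hq (abs_nonneg _) ((abs_nonneg _).trans (hE y x))).trans ?_
      rw [mul_assoc, ← div_eq_mul_inv, abs_sub_comm y x]
      exact mul_le_mul_of_nonneg_left (hφ.div_le_diniKernel h0 h1) hE0
    · rw [hK]
      simp only [if_neg h1.not_ge, mul_zero, sub_zero]
      rw [abs_mul]
      have hs : 0 < |x - y| := zero_lt_one.trans h1
      rcases le_or_gt |x - y| R with h2 | h2
      · have h3 : (Metric.closedBall x R).indicator (fun _ => N') y = N' :=
          indicator_of_mem (by rwa [Metric.mem_closedBall, dist_comm, Real.dist_eq]) _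
        rw [h3]
        have h4 : |x - y|⁻¹ ≤ 1 := inv_le_one_of_one_le₀ h1.le
        have h5 := mul_le_mul (hG.abs_le y) (hq.trans h4) (abs_nonneg _) hN'
        linarith
      · have h3 : |G y| * |(x - y) / ((x - y) ^ 2 + h ^ 2)| ≤ |G y| * |x - y|⁻¹ :=
          mul_le_mul_of_nonneg_left hq (abs_nonneg _)
        have h4 : |G y| * |x - y|⁻¹ ≤ lam / 2 * G y ^ 2 + lam⁻¹ / 2 * (|x - y|⁻¹) ^ 2 := by
          have h5 : lam / 2 * G y ^ 2 + lam⁻¹ / 2 * (|x - y|⁻¹) ^ 2 - |G y| * |x - y|⁻¹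
              = lam / 2 * (|G y| - lam⁻¹ * |x - y|⁻¹) ^ 2 := by
            rw [← sq_abs (G y)]
            field_simp
            ring
          have h6 : 0 ≤ lam / 2 * (|G y| - lam⁻¹ * |x - y|⁻¹) ^ 2 := by positivity
          linarith
        have h7 : lam⁻¹ / 2 * (|x - y|⁻¹) ^ 2 ≤ (lam * R)⁻¹ * (R / ((x - y) ^ 2 + R ^ 2)) := by
          have h8 : (lam * R)⁻¹ * (R / ((x - y) ^ 2 + R ^ 2)) = lam⁻¹ * ((x - y) ^ 2 + R ^ 2)⁻¹ := by
            field_simp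
          rw [h8, div_mul_eq_mul_div, mul_div_assoc]
          refine mul_le_mul_of_nonneg_left ?_ (inv_nonneg.2 hlam0.le)
          have h0 : 0 < (x - y) ^ 2 := by rw [← sq_abs]; positivity
          rw [inv_pow, sq_abs, inv_eq_one_div, inv_eq_one_div, div_div,
            div_le_div_iff₀ (by positivity) (by positivity)]
          have : R ^ 2 ≤ (x - y) ^ 2 := by
            rw [← sq_abs (x - y)]
            exact pow_le_pow_left₀ hR0.le h2.le 2
          linarith
        linarith
  have h1 := norm_integral_le_of_norm_le
    (f := fun y => G y * ((x - y) / ((x - y) ^ 2 + h ^ 2)) - G x * K (x - y))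
    (((i1.add i2).add i3).add i4) (ae_of_all _ hb)
  have i12 := i1.add i2
  have i123 := i12.add i3
  rw [integral_add' i123 i4, integral_add' i12 i3, integral_add' i1 i2, integral_const_mul,
    integral_const_mul, integral_const_mul, integral_poissonKernel_sub hR0,
    integral_sub_left_eq_self (diniKernel φ θ), integral_indicator measurableSet_closedBall,
    setIntegral_const, measureReal_def, Real.volume_closedBall,
    ENNReal.toReal_ofReal (by positivity), smul_eq_mul] at h1
  rw [e]
  refine h1.trans ?_
  have h2 : lam / 2 * ∫ y, G y ^ 2 ≤ m / 2 := by
    refine (mul_le_mul_of_nonneg_left hGm (by positivity)).trans (le_of_eq ?_)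
    rw [hlam]
    field_simp
  have h3 : (lam * R)⁻¹ * Real.pi ≤ m / 2 := by
    rw [mul_inv, hlam, inv_inv, ← div_eq_mul_inv, div_mul_eq_mul_div, div_le_iff₀ hR0, hR]
    nlinarith
  linarith

end

/-! ### Norms -/

lemma normC0_nonneg (F : ℝ → ℝ) : 0 ≤ normC0 F := Real.iSup_nonneg fun _ => abs_nonneg _

lemma abs_le_normC0 {F : ℝ → ℝ} (h : ∃ M, ∀ x, |F x| ≤ M) (x : ℝ) : |F x| ≤ normC0 F := by
  obtain ⟨M, hM⟩ := h
  exact le_ciSup (f := fun x => |F x|) ⟨M, by rintro _ ⟨y, rfl⟩; exact hM y⟩ x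

lemma normC0_le {F : ℝ → ℝ} {M : ℝ} (h : ∀ x, |F x| ≤ M) : normC0 F ≤ M := ciSup_le h

lemma seminormCPhi_nonneg {φ : ℝ → ℝ} (hφ : IsModulus φ) (F : ℝ → ℝ) : 0 ≤ seminormCPhi φ F :=
  Real.iSup_nonneg fun _ => div_nonneg (abs_nonneg _) (hφ.nonneg (abs_nonneg _))

lemma seminormCPhi_le {φ F : ℝ → ℝ} (hφ : IsModulus φ) {B : ℝ} (hB : 0 ≤ B)
    (h : ∀ x y, |F x - F y| ≤ B * φ |x - y|) : seminormCPhi φ F ≤ B :=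
  ciSup_le fun p => div_le_of_le_mul₀ (hφ.nonneg (abs_nonneg _)) hB (h p.1 p.2)

lemma MemCPhi.cPhiBound {φ F : ℝ → ℝ} (hφ : IsModulus φ) (hF : MemCPhi φ F) :
    CPhiBound φ F (seminormCPhi φ F) (normC0 F) := by
  refine ⟨abs_le_normC0 hF.bounded, fun x y => ?_, seminormCPhi_nonneg hφ F⟩
  obtain ⟨M, hM⟩ := hF.modulus
  rcases eq_or_ne x y with rfl | hxy
  · simp [hφ.zero]
  rw [← div_le_iff₀ (hφ.pos _ (abs_pos.2 (sub_ne_zero.2 hxy)))]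
  refine le_ciSup (f := fun p : ℝ × ℝ => |F p.1 - F p.2| / φ |p.1 - p.2|) ⟨|M|, ?_⟩ (x, y)
  rintro _ ⟨p, rfl⟩
  have h0 := hφ.nonneg (abs_nonneg (p.1 - p.2))
  exact div_le_of_le_mul₀ h0 (abs_nonneg M)
    ((hM _ _).trans (mul_le_mul_of_nonneg_right (le_abs_self M) h0))

/-- Interpolation between the sup norm and the modulus of continuity. -/
lemma CPhiBound.abs_sub_le_rpow {φ G : ℝ → ℝ} {S N K θ : ℝ} (hφ : IsModulus φ)
    (hG : CPhiBound φ G S N) (hSK : S ≤ K) (hθ0 : 0 < θ) (hθ1 : θ < 1) (x y : ℝ) :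
    |G x - G y| ≤ 2 * (K ^ θ * N ^ (1 - θ)) * φ |x - y| ^ θ := by
  have hφ0 := hφ.nonneg (abs_nonneg (x - y))
  have hK : 0 ≤ K := hG.nonneg.trans hSK
  have hN := hG.nonneg'
  have h1 : |G x - G y| ≤ K * φ |x - y| :=
    (hG.abs_sub_le x y).trans (mul_le_mul_of_nonneg_right hSK hφ0)
  have h2 := hG.abs_sub_le_two x y
  have h3 : (2 : ℝ) ^ (1 - θ) ≤ 2 := by
    simpa using Real.rpow_le_rpow_of_exponent_le one_le_two (by linarith : 1 - θ ≤ 1)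
  calc |G x - G y| = |G x - G y| ^ θ * |G x - G y| ^ (1 - θ) := by
        rw [← Real.rpow_add_of_nonneg (abs_nonneg _) hθ0.le (by linarith), add_sub_cancel,
          Real.rpow_one]
    _ ≤ (K * φ |x - y|) ^ θ * (2 * N) ^ (1 - θ) := by
        gcongr
    _ = 2 ^ (1 - θ) * (K ^ θ * N ^ (1 - θ) * φ |x - y| ^ θ) := by
        rw [Real.mul_rpow hK hφ0, Real.mul_rpow zero_le_two hN]
        ring
    _ ≤ 2 * (K ^ θ * N ^ (1 - θ) * φ |x - y| ^ θ) := by gcongr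
    _ = _ := by ring

lemma rpow_mul_rpow_le {K N θ : ℝ} (hN : 0 ≤ N) (hNK : N ≤ K) (hθ0 : 0 < θ) (hθ1 : θ < 1) :
    K ^ θ * N ^ (1 - θ) ≤ K := by
  have hK := hN.trans hNK
  calc K ^ θ * N ^ (1 - θ) ≤ K ^ θ * K ^ (1 - θ) := by
        gcongr
    _ = K := by
        rw [← Real.rpow_add_of_nonneg hK hθ0.le (by linarith), add_sub_cancel, Real.rpow_one]

lemma integral_sq_le_of_diam_le {g : ℝ → ℝ} (hg : Continuous g) (hgs : HasCompactSupport g) {L : ℝ}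
    (hL : Metric.diam (tsupport g) ≤ L) : ∫ y, g y ^ 2 ≤ L * normC0 g ^ 2 := by
  have hb := hgs.exists_bound_of_continuous hg
  have hfin : volume (tsupport g) < ⊤ := hgs.isCompact.measure_lt_top
  have h1 : ∫ y in tsupport g, g y ^ 2 = ∫ y, g y ^ 2 :=
    setIntegral_eq_integral_of_forall_compl_eq_zero fun x hx => by
      simp [image_eq_zero_of_notMem_tsupport hx]
  have h2 := norm_setIntegral_le_of_norm_le_const (f := fun y => g y ^ 2) (C := normC0 g ^ 2) hfin
    fun x _ => by
      rw [norm_pow, Real.norm_eq_abs]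
      exact pow_le_pow_left₀ (abs_nonneg _) (abs_le_normC0 hb x) 2
  have h3 : volume.real (tsupport g) ≤ Metric.diam (tsupport g) :=
    ENNReal.toReal_mono hgs.isCompact.isBounded.ediam_ne_top (Real.volume_le_diam _)
  rw [← h1]
  refine (le_abs_self _).trans (h2.trans ?_)
  rw [mul_comm]
  exact mul_le_mul_of_nonneg_right (h3.trans hL) (sq_nonneg _)

lemma integral_abs_mul_abs_le {F G : ℝ → ℝ} (hF : MemLp F 2) (hG : MemLp G 2) {L m m' : ℝ}
    (hL : 0 ≤ L) (hm : 0 ≤ m) (hm' : 0 ≤ m') (hFm : ∫ y, F y ^ 2 ≤ L * m ^ 2)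
    (hGm : ∫ y, G y ^ 2 ≤ L * m' ^ 2) : ∫ y, |F y| * |G y| ≤ L * m * m' := by
  have h1 := integral_mul_le_Lp_mul_Lq_of_nonneg (μ := volume) Real.HolderConjugate.two_two
    (f := fun y => |F y|) (g := fun y => |G y|) (ae_of_all _ fun y => abs_nonneg _)
    (ae_of_all _ fun y => abs_nonneg _) (by rw [ENNReal.ofReal_ofNat]; exact hF.abs)
    (by rw [ENNReal.ofReal_ofNat]; exact hG.abs)
  simp only [Real.rpow_ofNat, sq_abs, ← Real.sqrt_eq_rpow] at h1
  refine h1.trans ?_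
  calc _ ≤ √(L * m ^ 2) * √(L * m' ^ 2) :=
        mul_le_mul (Real.sqrt_le_sqrt hFm) (Real.sqrt_le_sqrt hGm) (Real.sqrt_nonneg _)
          (Real.sqrt_nonneg _)
    _ = L * m * m' := by
        rw [Real.sqrt_mul hL, Real.sqrt_mul hL, Real.sqrt_sq hm, Real.sqrt_sq hm',
          mul_mul_mul_comm, Real.mul_self_sqrt hL, mul_assoc]

/-- Either `φ` dominates a linear function near `0`, or `C^φ` contains only constants. -/
lemma exists_linear_lower_bound_or_const {φ : ℝ → ℝ} (hφ : IsModulus φ) :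
    (∃ c, 0 < c ∧ ∀ h, 0 < h → h ≤ 1 → c * h ≤ φ h) ∨
      ∀ (F : ℝ → ℝ) (S N : ℝ), CPhiBound φ F S N → ∀ x y, F x = F y := by
  refine or_iff_not_imp_left.2 fun hne F S N hF x y => ?_
  push Not at hne
  by_contra hxy
  have hd : 0 < |x - y| := abs_pos.2 (sub_ne_zero.2 fun h => hxy (congrArg F h))
  have hφd := hφ.pos _ hd
  have hS := hF.nonneg
  have hpos : 0 < |F x - F y| := abs_pos.2 (sub_ne_zero.2 hxy)
  -- The first entry forces h < |x - y|, since otherwise φ(h) ≥ φ(|x - y|) ≥ c h. The second makes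
  -- the chained bound 2S|x - y|c strictly smaller than |F x - F y|; the +1 supplies the strictness.
  set c := min (φ |x - y|) (|F x - F y| / (2 * S * |x - y| + 1)) with hc
  obtain ⟨h, hh, hh1, hlt⟩ := hne c (lt_min hφd (by positivity))
  have hlt1 : h < |x - y| := by
    by_contra hle
    have h1 := hφ.le hd.le (not_lt.1 hle)
    have h2 : c * h ≤ φ |x - y| * 1 := mul_le_mul (min_le_left _ _) hh1 hh.le hφd.le
    linarith
  have h1 := hF.abs_sub_le_of_ge hφ hh hlt1.le
  have h2 : S * φ h * (2 * |x - y| / h) ≤ 2 * S * |x - y| * c := by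
    have h3 : φ h / h ≤ c := by rw [div_le_iff₀ hh]; exact hlt.le
    calc S * φ h * (2 * |x - y| / h) = 2 * S * |x - y| * (φ h / h) := by ring
      _ ≤ _ := by gcongr
  have h4 : c * (2 * S * |x - y| + 1) ≤ |F x - F y| := by
    rw [← le_div_iff₀ (by positivity)]
    exact min_le_right _ _
  have h5 : 0 < c := lt_min hφd (by positivity)
  linarith

/-! ### The Hilbert transform of a product. -/

lemma HasPV.unique {k : ℝ → ℝ} {x v v' : ℝ} (h : HasPV k x v) (h' : HasPV k x v') : v = v' :=
  tendsto_nhds_unique h.2 h'.2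

lemma IsConjugate.of_hasHilbertAt {φ f F : ℝ → ℝ} (hφ : IsModulus φ) (hf : Continuous f)
    (hfs : HasCompactSupport f) (hF : MemCPhi φ F) (h : ∀ᵐ x, HasHilbertAt f x (F x)) :
    IsConjugate f F :=
  ⟨hf, hfs, (hF.cPhiBound hφ).continuous hφ, hF.bounded,
    h.mono fun x hx => (hasHilbertAt_iff hf hfs x (F x)).1 hx⟩

lemma IsConjugate.abs_conjPoisson_le {f F : ℝ → ℝ} (hf : IsConjugate f F) {h : ℝ} (hh : 0 < h)
    (x : ℝ) : |conjPoisson F h x| ≤ Real.pi * normC0 f := by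
  rw [hf.conjPoisson_eq hh, abs_neg]
  exact abs_poisson_le (abs_le_normC0 hf.bdd_left) hh x

/-- The sup norm of `g` is controlled by its Hilbert transform. -/
lemma IsConjugate.normC0_le {φ g G : ℝ → ℝ} {θ S' N' E L : ℝ} (hg : IsConjugate g G)
    (hφ : IsModulus φ) (hG : CPhiBound φ G S' N')
    (hE : ∀ x y, |G x - G y| ≤ E * φ |x - y| ^ θ) (hE0 : 0 ≤ E)
    (hψ : Integrable (diniKernel φ θ)) (hL : 0 < L) (hdiam : Metric.diam (tsupport g) ≤ L) :
    normC0 g ≤ E * (∫ s, diniKernel φ θ s) + 2 * (2 * Real.pi * L + 1) * N' := by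
  obtain ⟨M, hM⟩ := hg.bdd_left
  set B := E * (∫ s, diniKernel φ θ s) + 2 * (2 * Real.pi * L + 1) * N' with hB
  have hGm : ∫ y, G y ^ 2 ≤ L * normC0 g ^ 2 :=
    hg.integral_sq_le.trans (integral_sq_le_of_diam_le hg.cont hg.supp hdiam)
  have h1 : ∀ x, Real.pi * |g x| ≤ B + normC0 g := fun x => by
    have h2 := (tendsto_poisson hg.cont hM x).abs
    rw [abs_mul, abs_of_pos Real.pi_pos] at h2
    refine le_of_tendsto h2 (eventually_mem_nhdsWithin.mono fun h hh => ?_)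
    rw [← abs_neg, ← hg.conjPoisson_eq hh]
    exact _root_.abs_conjPoisson_le hφ hG hE hE0 hψ hL (normC0_nonneg g) hg.memLp hGm hh x
  have h3 : normC0 g ≤ (B + normC0 g) / Real.pi := _root_.normC0_le fun x => by
    rw [le_div_iff₀ Real.pi_pos, mul_comm]
    exact h1 x
  rw [le_div_iff₀ Real.pi_pos] at h3
  -- π‖g‖ ≤ B + ‖g‖ and π ≥ 2, so the term ‖g‖ is absorbed on the left.
  nlinarith [Real.two_le_pi, normC0_nonneg g]

section

variable {φ f g F G : ℝ → ℝ} {θ S N S' N' E : ℝ} (hφ : IsModulus φ) (hf : IsConjugate f F)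
  (hg : IsConjugate g G) (hF : CPhiBound φ F S N)
  (hG : CPhiBound φ G S' N') (hE : ∀ x y, |G x - G y| ≤ E * φ |x - y| ^ θ) (hE0 : 0 ≤ E)
  (hψ : Integrable (diniKernel φ θ))

include hφ hf hg hF hG hE hE0 hψ

lemma hasPV_nearPart_add_farPart {h : ℝ} (hh : 0 < h) (hh1 : h ≤ 1) (x : ℝ) :
    HasPV (fun y => (F x - F y) * (G x - G y) / (x - y)) x
      (nearPart F G h x + farPart F G h x) :=
  hasPV_increments hf.memLp hg.memLp hh x (integrable_nearPart hφ hF hG hE hE0 hψ hh hh1 x)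

omit hf hg in
lemma tendsto_nearPart (x : ℝ) : Tendsto (fun h => nearPart F G h x) (𝓝[>] 0) (𝓝 0) := by
  have h1 : Tendsto (fun h => φ h * (S * E * ∫ s, diniKernel φ θ s)
      + φ h * (4 * Real.pi * S * N')) (𝓝[>] 0) (𝓝 0) := by
    simpa using (hφ.tendsto_zero.mul_const (S * E * ∫ s, diniKernel φ θ s)).add
      (hφ.tendsto_zero.mul_const (4 * Real.pi * S * N'))
  refine squeeze_zero_norm' ?_ h1
  have h2 : ∀ᶠ r : ℝ in 𝓝[>] 0, r ≤ 1 := nhdsWithin_le_nhds (Iic_mem_nhds one_pos)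
  filter_upwards [h2, self_mem_nhdsWithin] with h hh1 hh
  exact abs_nearPart_le hφ hF hG hE hE0 hψ hh hh1 x

/-- The Hilbert transform of the product is the principal value of the product of increments. -/
lemma hasHilbertAt_mul (x : ℝ) :
    HasHilbertAt (fun y => f y * g y) x
      (1 / Real.pi * (nearPart F G 1 x + farPart F G 1 x)) := by
  obtain ⟨Mf, hMf⟩ := hf.bdd_left
  obtain ⟨Mg, hMg⟩ := hg.bdd_left
  have hfg : Continuous fun y => f y * g y := hf.cont.mul hg.cont
  have hfgs : HasCompactSupport fun y => f y * g y := hf.supp.mul_right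
  rw [hasHilbertAt_iff hfg hfgs, ← mul_assoc,
    mul_one_div_cancel Real.pi_ne_zero, one_mul]
  have hv : Continuous fun y => f y * G y + g y * F y :=
    (hf.cont.mul hg.cont_conj).add (hg.cont.mul hf.cont_conj)
  have hvb : ∀ y, |f y * G y + g y * F y| ≤ Mf * N' + Mg * N := fun y => by
    refine (abs_add_le _ _).trans (add_le_add ?_ ?_) <;> rw [abs_mul]
    · exact mul_le_mul (hMf y) (hG.abs_le y) (abs_nonneg _) ((abs_nonneg _).trans (hMf y))
    · exact mul_le_mul (hMg y) (hF.abs_le y) (abs_nonneg _) ((abs_nonneg _).trans (hMg y))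
  -- With V = near + far, independent of the height, the identities read Q_h(fg) = V - near_h - (F
  -- P_h g + G P_h f) + P_h(fG + gF) at x. The Poisson terms cancel in the limit.
  have h1 := (((tendsto_const_nhds (x := nearPart F G 1 x + farPart F G 1 x)).sub
    (tendsto_nearPart hφ hF hG hE hE0 hψ x)).sub
    (((tendsto_poisson hg.cont hMg x).const_mul (F x)).add
      ((tendsto_poisson hf.cont hMf x).const_mul (G x)))).add (tendsto_poisson hv hvb x)
  have e : nearPart F G 1 x + farPart F G 1 x - 0
      - (F x * (Real.pi * g x) + G x * (Real.pi * f x)) + Real.pi * (f x * G x + g x * F x)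
      = nearPart F G 1 x + farPart F G 1 x := by ring
  rw [e] at h1
  refine h1.congr' ?_
  have h2 : ∀ᶠ r : ℝ in 𝓝[>] 0, r ≤ 1 := nhdsWithin_le_nhds (Iic_mem_nhds one_pos)
  filter_upwards [h2, self_mem_nhdsWithin] with h hh1 hh
  have h3 := (hasPV_nearPart_add_farPart hφ hf hg hF hG hE hE0 hψ one_pos le_rfl x).unique
    (hasPV_nearPart_add_farPart hφ hf hg hF hG hE hE0 hψ hh hh1 x)
  rw [h3, farPart, hf.conjPoisson_mul_eq hg hh, hf.conjPoisson_eq hh, hg.conjPoisson_eq hh]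
  ring

/-- At height 1 the conjugate Poisson kernel is bounded by 1, so the term with FG is controlled by
Cauchy–Schwarz, and the other two become Poisson integrals of f and g. -/
lemma abs_nearPart_add_farPart_le {L m m' : ℝ} (hL : 0 ≤ L)
    (hFm : ∫ y, F y ^ 2 ≤ L * m ^ 2) (hGm : ∫ y, G y ^ 2 ≤ L * m' ^ 2)
    (hm : normC0 f ≤ m) (hm' : normC0 g ≤ m') (x : ℝ) :
    |nearPart F G 1 x + farPart F G 1 x|
      ≤ φ 1 * (S * E * ∫ s, diniKernel φ θ s) + φ 1 * (4 * Real.pi * S * N')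
        + L * m * m' + Real.pi * (N * m') + Real.pi * (N' * m) := by
  have h1 := abs_nearPart_le hφ hF hG hE hE0 hψ one_pos le_rfl x
  have hm0 := (normC0_nonneg f).trans hm
  have hm0' := (normC0_nonneg g).trans hm'
  have h2 : |conjPoisson (fun y => F y * G y) 1 x| ≤ L * m * m' := by
    refine (norm_integral_le_of_norm_le
      (f := fun y => F y * G y * ((x - y) / ((x - y) ^ 2 + 1 ^ 2)))
      (hf.memLp.abs.integrable_mul hg.memLp.abs)
      (ae_of_all _ fun y => ?_)).trans
      (integral_abs_mul_abs_le hf.memLp hg.memLp hL hm0 hm0' hFm hGm)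
    rw [norm_mul, norm_mul]
    have := abs_conjPoissonKernel_le one_pos (x - y)
    rw [inv_one] at this
    exact mul_le_of_le_one_right (by positivity) this
  have h3 : |F x * conjPoisson G 1 x| ≤ Real.pi * (N * m') := by
    rw [abs_mul, mul_left_comm]
    exact mul_le_mul (hF.abs_le x) ((hg.abs_conjPoisson_le one_pos x).trans
      (mul_le_mul_of_nonneg_left hm' Real.pi_pos.le)) (abs_nonneg _) hF.nonneg'
  have h4 : |G x * conjPoisson F 1 x| ≤ Real.pi * (N' * m) := by
    rw [abs_mul, mul_left_comm]
    exact mul_le_mul (hG.abs_le x) ((hf.abs_conjPoisson_le one_pos x).trans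
      (mul_le_mul_of_nonneg_left hm Real.pi_pos.le)) (abs_nonneg _) hG.nonneg'
  have h5 := abs_add_le (nearPart F G 1 x) (farPart F G 1 x)
  have h6 : |farPart F G 1 x| ≤ L * m * m' + Real.pi * (N * m') + Real.pi * (N' * m) :=
    (abs_sub _ _).trans (add_le_add ((abs_sub _ _).trans (add_le_add h2 h3)) h4)
  linarith

/-- The value at height 1 equals the value at height |x - x'|, by uniqueness of the principal value,
and there each part is of size φ(|x - x'|). -/
lemma abs_nearPart_add_farPart_sub_le {m m' c : ℝ} (hc : 0 < c)
    (hch : ∀ h, 0 < h → h ≤ 1 → c * h ≤ φ h)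
    (hm : normC0 f ≤ m) (hm' : normC0 g ≤ m') {x x' : ℝ} (hx : x ≠ x') (hx1 : |x - x'| ≤ 1) :
    |nearPart F G 1 x + farPart F G 1 x - (nearPart F G 1 x' + farPart F G 1 x')|
      ≤ (6 * (S * E * ∫ s, diniKernel φ θ s) + 12 * Real.pi * (S * N')
        + 16 * Real.pi / c * (N * N') + Real.pi * (S * m') + Real.pi * (S' * m))
        * φ |x - x'| := by
  have hh : 0 < |x - x'| := abs_pos.2 (sub_ne_zero.2 hx)
  have e : ∀ z, nearPart F G 1 z + farPart F G 1 z
      = nearPart F G |x - x'| z + farPart F G |x - x'| z := fun z =>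
    (hasPV_nearPart_add_farPart hφ hf hg hF hG hE hE0 hψ one_pos le_rfl z).unique
      (hasPV_nearPart_add_farPart hφ hf hg hF hG hE hE0 hψ hh hx1 z)
  rw [e x, e x', add_sub_add_comm]
  have h1 := abs_nearPart_le hφ hF hG hE hE0 hψ hh hx1 x
  have h2 := abs_nearPart_le hφ hF hG hE hE0 hψ hh hx1 x'
  have h3 := abs_farPart_sub_le hφ hF hG hE hE0 hψ (m := Real.pi * m) (m' := Real.pi * m') hc hh
    (hch _ hh hx1) hf.memLp hg.memLp
    (fun z => (hf.abs_conjPoisson_le hh z).trans (mul_le_mul_of_nonneg_left hm Real.pi_pos.le))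
    (fun z => (hg.abs_conjPoisson_le hh z).trans (mul_le_mul_of_nonneg_left hm' Real.pi_pos.le))
    (x := x) (x' := x') rfl
  refine (abs_add_le _ _).trans ((add_le_add ((abs_sub _ _).trans (add_le_add h1 h2)) h3).trans
    (le_of_eq ?_))
  ring

end

/-- The sup norm of a function is controlled by its Hilbert transform, with a constant depending only
on the modulus and on the size of the support. -/
lemma exists_const_normC0_le {φ : ℝ → ℝ} (hφ : IsModulus φ) {θ : ℝ} (hθ0 : 0 < θ) (hθ1 : θ < 1)
    (hψ : Integrable (diniKernel φ θ)) {L : ℝ} (hL : 0 < L) :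
    ∃ c₁ : ℝ, 0 ≤ c₁ ∧ ∀ g G : ℝ → ℝ, IsConjugate g G → MemCPhi φ G →
      Metric.diam (tsupport g) ≤ L →
      normC0 g ≤ c₁ * (normCPhi φ G ^ θ * normC0 G ^ (1 - θ) + normC0 G) := by
  have hD0 : 0 ≤ ∫ s, diniKernel φ θ s := integral_nonneg hφ.diniKernel_nonneg
  have hπ := Real.pi_pos
  refine ⟨2 * (∫ s, diniKernel φ θ s) + 2 * (2 * Real.pi * L + 1), by positivity,
    fun g G hg hG hdg => ?_⟩
  have bG := hG.cPhiBound hφ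
  have hN := bG.nonneg'
  have hSK : seminormCPhi φ G ≤ normCPhi φ G := le_add_of_nonneg_left hN
  have hK := bG.nonneg.trans hSK
  have hE0 : 0 ≤ normCPhi φ G ^ θ * normC0 G ^ (1 - θ) := by positivity
  refine (hg.normC0_le hφ bG (bG.abs_sub_le_rpow hφ hSK hθ0 hθ1) (by positivity) hψ hL
    hdg).trans ?_
  set E := normCPhi φ G ^ θ * normC0 G ^ (1 - θ)
  set D := ∫ s, diniKernel φ θ s
  have h1 : 0 ≤ 2 * D * normC0 G := by positivity
  have h2 : 0 ≤ 2 * (2 * Real.pi * L + 1) * E := by positivity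
  linarith

/-- The estimates for the Hilbert transform of the product when `φ` dominates a linear function near
`0`. -/
lemma exists_const_abs_le {φ : ℝ → ℝ} (hφ : IsModulus φ) {θ : ℝ} (hθ0 : 0 < θ) (hθ1 : θ < 1)
    (hψ : Integrable (diniKernel φ θ)) {L : ℝ} (hL : 0 < L) {c : ℝ} (hc : 0 < c)
    (hch : ∀ h, 0 < h → h ≤ 1 → c * h ≤ φ h) :
    ∃ A B : ℝ, 0 ≤ A ∧ 0 ≤ B ∧ ∀ f g F G : ℝ → ℝ, IsConjugate f F → IsConjugate g G →
      MemCPhi φ F → MemCPhi φ G →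
      Metric.diam (tsupport f) ≤ L → Metric.diam (tsupport g) ≤ L →
      (∀ x, |nearPart F G 1 x + farPart F G 1 x| ≤
        A * (normCPhi φ F * (normCPhi φ G ^ θ * normC0 G ^ (1 - θ) + normC0 G)
            + normCPhi φ G * (normC0 f + normC0 F))) ∧
      ∀ x x', |nearPart F G 1 x + farPart F G 1 x - (nearPart F G 1 x' + farPart F G 1 x')| ≤
        B * (normCPhi φ F * (normCPhi φ G ^ θ * normC0 G ^ (1 - θ) + normC0 G)
            + normCPhi φ G * (normC0 f + normC0 F)) * φ |x - x'| := by
  set D := ∫ s, diniKernel φ θ s with hD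
  have hD0 : 0 ≤ D := integral_nonneg hφ.diniKernel_nonneg
  have hφ1 : 0 < φ 1 := hφ.pos 1 one_pos
  have hπ := Real.pi_pos
  obtain ⟨c₁, hc₁0, hc₁⟩ := exists_const_normC0_le hφ hθ0 hθ1 hψ hL
  -- The summands match those of `abs_nearPart_add_farPart_le`; 2Lc₁² comes from ‖f‖ ≤ 2c₁K together
  -- with ‖g‖ ≤ c₁(E + N').
  set A := 2 * φ 1 * D + 4 * Real.pi * φ 1 + 2 * L * c₁ ^ 2 + Real.pi * c₁ + Real.pi with hA
  -- The last summand serves |x - x'| > 1, where the sup bound is used twice and φ(|x - x'|) ≥ φ(1);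
  -- the others serve |x - x'| ≤ 1.
  set B := 12 * D + 12 * Real.pi + 16 * Real.pi / c + Real.pi * c₁ + Real.pi + 2 * A / φ 1 with hB
  have hA0 : 0 ≤ A := by positivity
  refine ⟨A, B, hA0, by positivity, fun f g F G hf hg hF hG hdf hdg => ?_⟩
  have bF := hF.cPhiBound hφ
  have bG := hG.cPhiBound hφ
  set S := seminormCPhi φ F with hS
  set S' := seminormCPhi φ G with hS'
  set N := normC0 F with hN
  set N' := normC0 G with hN'
  set K := normCPhi φ F with hK
  set K' := normCPhi φ G with hK'
  set E := K' ^ θ * N' ^ (1 - θ) with hE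
  set m := normC0 f with hm
  set m' := normC0 g with hm'
  set X := K * (E + N') + K' * (m + N) with hX
  have hS0 : 0 ≤ S := bF.nonneg
  have hS'0 : 0 ≤ S' := bG.nonneg
  have hN0 : 0 ≤ N := bF.nonneg'
  have hN'0 : 0 ≤ N' := bG.nonneg'
  have hm0 : 0 ≤ m := normC0_nonneg f
  have hm'0 : 0 ≤ m' := normC0_nonneg g
  have hSK : S ≤ K := le_add_of_nonneg_left hN0
  have hSK' : S' ≤ K' := le_add_of_nonneg_left hN'0
  have hNK : N ≤ K := le_add_of_nonneg_right hS0
  have hNK' : N' ≤ K' := le_add_of_nonneg_right hS'0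
  have hK0 : 0 ≤ K := hS0.trans hSK
  have hK'0 : 0 ≤ K' := hS'0.trans hSK'
  have hE0 : 0 ≤ E := by positivity
  have hEG : ∀ x y, |G x - G y| ≤ 2 * E * φ |x - y| ^ θ := bG.abs_sub_le_rpow hφ hSK' hθ0 hθ1
  have hEK : K ^ θ * N ^ (1 - θ) ≤ K := rpow_mul_rpow_le hN0 hNK hθ0 hθ1
  have hm1 : m ≤ 2 * c₁ * K := by
    calc m ≤ c₁ * (K ^ θ * N ^ (1 - θ) + N) := hc₁ f F hf hF hdf
      _ ≤ c₁ * (K + K) := by gcongr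
      _ = _ := by ring
  have hm'1 : m' ≤ c₁ * (E + N') := hc₁ g G hg hG hdg
  have hEN : 0 ≤ E + N' := by positivity
  have hX0 : 0 ≤ X := by positivity
  have ha : K * (E + N') ≤ X := le_add_of_nonneg_right (by positivity)
  have hb : K' * (m + N) ≤ X := le_add_of_nonneg_left (by positivity)
  have e1 : S * E ≤ X := (mul_le_mul hSK (le_add_of_nonneg_right hN'0) hE0 hK0).trans ha
  have e2 : S * N' ≤ X := (mul_le_mul hSK (le_add_of_nonneg_left hE0) hN'0 hK0).trans ha
  have e3 : N * N' ≤ X := (mul_le_mul hNK (le_add_of_nonneg_left hE0) hN'0 hK0).trans ha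
  have e4 : ∀ u, 0 ≤ u → u ≤ K → u * m' ≤ c₁ * X := fun u hu huK => by
    calc u * m' ≤ K * (c₁ * (E + N')) := mul_le_mul huK hm'1 hm'0 hK0
      _ = c₁ * (K * (E + N')) := by ring
      _ ≤ _ := mul_le_mul_of_nonneg_left ha hc₁0
  have e5 : ∀ u, 0 ≤ u → u ≤ K' → u * m ≤ X := fun u hu huK =>
    (mul_le_mul huK (le_add_of_nonneg_right hN0) hm0 hK'0).trans hb
  have e6 : m * m' ≤ 2 * c₁ ^ 2 * X := by
    calc m * m' ≤ 2 * c₁ * K * m' := mul_le_mul_of_nonneg_right hm1 hm'0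
      _ = 2 * c₁ * (K * m') := by ring
      _ ≤ 2 * c₁ * (c₁ * X) := mul_le_mul_of_nonneg_left (e4 K hK0 le_rfl) (by positivity)
      _ = _ := by ring
  have hsup : ∀ x, |nearPart F G 1 x + farPart F G 1 x| ≤ A * X := fun x => by
    refine (abs_nearPart_add_farPart_le hφ hf hg bF bG hEG (by positivity) hψ hL.le
      (hf.integral_sq_le.trans (integral_sq_le_of_diam_le hf.cont hf.supp hdf))
      (hg.integral_sq_le.trans (integral_sq_le_of_diam_le hg.cont hg.supp hdg))
      le_rfl le_rfl x).trans ?_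
    have h1 : φ 1 * (S * (2 * E) * D) ≤ 2 * φ 1 * D * X := by
      calc _ = 2 * φ 1 * D * (S * E) := by ring
        _ ≤ _ := by gcongr
    have h2 : φ 1 * (4 * Real.pi * S * N') ≤ 4 * Real.pi * φ 1 * X := by
      calc _ = 4 * Real.pi * φ 1 * (S * N') := by ring
        _ ≤ _ := by gcongr
    have h3 : L * m * m' ≤ 2 * L * c₁ ^ 2 * X := by
      calc _ = L * (m * m') := by ring
        _ ≤ L * (2 * c₁ ^ 2 * X) := by gcongr
        _ = _ := by ring
    have h4 : Real.pi * (N * m') ≤ Real.pi * (c₁ * X) :=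
      mul_le_mul_of_nonneg_left (e4 N hN0 hNK) hπ.le
    have h5 : Real.pi * (N' * m) ≤ Real.pi * X :=
      mul_le_mul_of_nonneg_left (e5 N' hN'0 hNK') hπ.le
    have h6 : A * X = 2 * φ 1 * D * X + 4 * Real.pi * φ 1 * X + 2 * L * c₁ ^ 2 * X
      + Real.pi * (c₁ * X) + Real.pi * X := by rw [hA]; ring
    linarith
  refine ⟨hsup, fun x x' => ?_⟩
  rcases eq_or_ne x x' with rfl | hx
  · simp [hφ.zero]
  rcases le_or_gt |x - x'| 1 with hx1 | hx1
  · refine (abs_nearPart_add_farPart_sub_le hφ hf hg bF bG hEG (by positivity) hψ hc hch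
      le_rfl le_rfl hx hx1).trans
      (mul_le_mul_of_nonneg_right ?_ (hφ.nonneg (abs_nonneg _)))
    have h1 : 6 * (S * (2 * E) * D) ≤ 12 * D * X := by
      calc _ = 12 * D * (S * E) := by ring
        _ ≤ _ := by gcongr
    have h2 : 12 * Real.pi * (S * N') ≤ 12 * Real.pi * X := by gcongr
    have h3 : 16 * Real.pi / c * (N * N') ≤ 16 * Real.pi / c * X := by gcongr
    have h4 : Real.pi * (S * m') ≤ Real.pi * (c₁ * X) :=
      mul_le_mul_of_nonneg_left (e4 S hS0 hSK) hπ.le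
    have h5 : Real.pi * (S' * m) ≤ Real.pi * X :=
      mul_le_mul_of_nonneg_left (e5 S' hS'0 hSK') hπ.le
    have h6 : B * X = 12 * D * X + 12 * Real.pi * X + 16 * Real.pi / c * X
      + Real.pi * (c₁ * X) + Real.pi * X + 2 * A / φ 1 * X := by rw [hB]; ring
    have h7 : 0 ≤ 2 * A / φ 1 * X := by positivity
    linarith
  · have h1 : φ 1 ≤ φ |x - x'| := hφ.le zero_le_one hx1.le
    have h2 : 2 * A / φ 1 ≤ B := by
      rw [hB]
      exact le_add_of_nonneg_left (by positivity)
    calc _ ≤ A * X + A * X := (abs_sub _ _).trans (add_le_add (hsup x) (hsup x'))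
      _ = 2 * A / φ 1 * X * φ 1 := by field_simp; ring
      _ ≤ B * X * φ |x - x'| := by gcongr

theorem lemma2p2 (φ : ℝ → ℝ) (hφ : IsModulus φ) (θ : ℝ) (hθ0 : 0 < θ) (hθ1 : θ < 1 / 2)
    (hDini : DiniPow φ θ) :
    -- the constant depends only on `φ`, `θ` and a bound `L` for the diameters of the supports
    ∀ L : ℝ, ∃ C : ℝ, ∀ f g Hf Hg : ℝ → ℝ,
      Continuous f → HasCompactSupport f → Metric.diam (tsupport f) ≤ L →
      Continuous g → HasCompactSupport g → Metric.diam (tsupport g) ≤ L →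
      (∀ᵐ x, HasHilbertAt f x (Hf x)) → MemCPhi φ Hf →
      (∀ᵐ x, HasHilbertAt g x (Hg x)) → MemCPhi φ Hg →
      ∃ Hfg : ℝ → ℝ,
        (∀ x, HasHilbertAt (fun y => f y * g y) x (Hfg x)) ∧
        MemCPhi φ Hfg ∧
        (∀ x, ∃ I : ℝ,
          HasPV (fun y => (Hf x - Hf y) * (Hg x - Hg y) / (x - y)) x I ∧
          Hfg x = (1 / Real.pi) * I) ∧
        normCPhi φ Hfg ≤
          C * (normCPhi φ Hf * (normCPhi φ Hg ^ θ * normC0 Hg ^ (1 - θ) + normC0 Hg)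
            + normCPhi φ Hg * (normC0 f + normC0 Hf)) ∧
        normCPhi φ Hfg ≤ C * (normCPhi φ Hf * normCPhi φ Hg) := by
  have hθ1' : θ < 1 := by linarith
  have hψ := hφ.integrable_diniKernel hθ0 hDini
  intro L
  -- The given L may be zero or negative, whereas the estimates divide by it.
  have hL' : 0 < max L 0 + 1 := by positivity
  have hLL' : L ≤ max L 0 + 1 := (le_max_left L 0).trans (by linarith)
  obtain ⟨A, B, hA, hB, key⟩ : ∃ A B : ℝ, 0 ≤ A ∧ 0 ≤ B ∧
      ∀ f g F G : ℝ → ℝ, IsConjugate f F → IsConjugate g G → MemCPhi φ F → MemCPhi φ G →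
      Metric.diam (tsupport f) ≤ max L 0 + 1 → Metric.diam (tsupport g) ≤ max L 0 + 1 →
      (∀ x, |nearPart F G 1 x + farPart F G 1 x| ≤
        A * (normCPhi φ F * (normCPhi φ G ^ θ * normC0 G ^ (1 - θ) + normC0 G)
            + normCPhi φ G * (normC0 f + normC0 F))) ∧
      ∀ x x', |nearPart F G 1 x + farPart F G 1 x - (nearPart F G 1 x' + farPart F G 1 x')| ≤
        B * (normCPhi φ F * (normCPhi φ G ^ θ * normC0 G ^ (1 - θ) + normC0 G)
            + normCPhi φ G * (normC0 f + normC0 F)) * φ |x - x'| := by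
    rcases exists_linear_lower_bound_or_const hφ with ⟨c, hc, hch⟩ | hconst
    · exact exists_const_abs_le hφ hθ0 hθ1' hψ hL' hc hch
    -- When F is constant all increments vanish, so the principal value is zero and both bounds hold
    -- with constant 0.
    · refine ⟨0, 0, le_rfl, le_rfl, fun f g F G hf hg hF hG _ _ => ?_⟩
      have h0 : ∀ x, nearPart F G 1 x + farPart F G 1 x = 0 := fun x => by
        have h1 : ∀ y, F x - F y = 0 := fun y =>
          sub_eq_zero.2 (hconst F _ _ (hF.cPhiBound hφ) x y)
        refine (hasPV_increments hf.memLp hg.memLp one_pos x (by simp [h1])).unique ?_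
        simp [HasPV, h1, IntegrableOn]
      simp [h0]
  obtain ⟨c₁, hc₁, hsupp⟩ := exists_const_normC0_le hφ hθ0 hθ1' hψ hL'
  -- A + B suffices for the first estimate. The factor 3 + 2c₁ passes to the second: 2 from E + N' ≤
  -- 2‖G‖, and 2c₁ + 1 from ‖f‖ + N ≤ (2c₁ + 1)‖F‖, in C^φ norms on the right.
  refine ⟨(A + B) * (3 + 2 * c₁), fun f g F G hfc hfs hdf hgc hgs hdg hfF hF hgG hG => ?_⟩
  have hf := IsConjugate.of_hasHilbertAt hφ hfc hfs hF hfF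
  have hg := IsConjugate.of_hasHilbertAt hφ hgc hgs hG hgG
  have bF := hF.cPhiBound hφ
  have bG := hG.cPhiBound hφ
  have hN0 := bF.nonneg'
  have hN'0 := bG.nonneg'
  have hNK : normC0 F ≤ normCPhi φ F := le_add_of_nonneg_right bF.nonneg
  have hNK' : normC0 G ≤ normCPhi φ G := le_add_of_nonneg_right bG.nonneg
  have hSK' : seminormCPhi φ G ≤ normCPhi φ G := le_add_of_nonneg_left hN'0
  have hK0 := hN0.trans hNK
  have hK'0 := hN'0.trans hNK'
  have hm0 := normC0_nonneg f
  obtain ⟨hsup, hmod⟩ := key f g F G hf hg hF hG (hdf.trans hLL') (hdg.trans hLL')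
  have hm1 := hsupp f F hf hF (hdf.trans hLL')
  have hEK := rpow_mul_rpow_le hN0 hNK hθ0 hθ1'
  have hEK' := rpow_mul_rpow_le hN'0 hNK' hθ0 hθ1'
  have hEG := bG.abs_sub_le_rpow hφ hSK' hθ0 hθ1'
  have hX0 : 0 ≤ normCPhi φ F * (normCPhi φ G ^ θ * normC0 G ^ (1 - θ) + normC0 G)
      + normCPhi φ G * (normC0 f + normC0 F) := by positivity
  have hXle : normCPhi φ F * (normCPhi φ G ^ θ * normC0 G ^ (1 - θ) + normC0 G)
      + normCPhi φ G * (normC0 f + normC0 F)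
      ≤ (3 + 2 * c₁) * (normCPhi φ F * normCPhi φ G) := by
    have h1 : normC0 f ≤ c₁ * (normCPhi φ F + normCPhi φ F) := hm1.trans (by gcongr)
    calc _ ≤ normCPhi φ F * (normCPhi φ G + normCPhi φ G)
          + normCPhi φ G * (c₁ * (normCPhi φ F + normCPhi φ F) + normCPhi φ F) := by gcongr
      _ = _ := by ring
  set X := normCPhi φ F * (normCPhi φ G ^ θ * normC0 G ^ (1 - θ) + normC0 G)
      + normCPhi φ G * (normC0 f + normC0 F) with hX
  have hπ1 : |1 / Real.pi| ≤ 1 := by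
    rw [abs_of_pos (by positivity), div_le_one Real.pi_pos]
    linarith [Real.two_le_pi]
  have hsup' : ∀ x, |1 / Real.pi * (nearPart F G 1 x + farPart F G 1 x)| ≤ A * X := fun x => by
    rw [abs_mul]
    exact (mul_le_of_le_one_left (abs_nonneg _) hπ1).trans (hsup x)
  have hmod' : ∀ x x', |1 / Real.pi * (nearPart F G 1 x + farPart F G 1 x)
      - 1 / Real.pi * (nearPart F G 1 x' + farPart F G 1 x')| ≤ B * X * φ |x - x'| := fun x x' => by
    rw [← mul_sub, abs_mul]
    exact (mul_le_of_le_one_left (abs_nonneg _) hπ1).trans (hmod x x')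
  have hnorm : normCPhi φ (fun x => 1 / Real.pi * (nearPart F G 1 x + farPart F G 1 x))
      ≤ (A + B) * X := by
    rw [add_mul]
    exact add_le_add (normC0_le hsup') (seminormCPhi_le hφ (by positivity) hmod')
  refine ⟨fun x => 1 / Real.pi * (nearPart F G 1 x + farPart F G 1 x),
    hasHilbertAt_mul hφ hf hg bF bG hEG (by positivity) hψ, ⟨⟨_, hsup'⟩, ⟨_, hmod'⟩⟩,
    fun x => ⟨_, hasPV_nearPart_add_farPart hφ hf hg bF bG hEG (by positivity) hψ one_pos le_rfl x,
      rfl⟩, hnorm.trans ?_, hnorm.trans ?_⟩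
  · exact mul_le_mul_of_nonneg_right (le_mul_of_one_le_right (by positivity) (by linarith)) hX0
  · rw [mul_assoc]
    exact mul_le_mul_of_nonneg_left hXle (by positivity)
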